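/- Let $M$ be an oriented smooth three-manifold, $\kappa\in\mathbb{R}$, and $J\subset\mathbb{R}$ an interval of positive length. Conventions: for a metric connection $\nabla$ on $(M,g)$, $\mathcal{R}^{\nabla}_{u,v}w=\nabla_u\nabla_v w-\nabla_v\nabla_u w-\nabla_{[u,v]}w$ and $\mathcal{R}^\nabla_{u,v}(a,b)=g(\mathcal{R}^\nabla_{u,v}a,b)$. For a three-form $H$, $\mathcal{R}^{g,H}$ is the curvature of $\nabla^{g,H}_uv=\nabla^g_uv-\tfrac12 H(u,v)^{\sharp_g}$, the metric connection with totally skew-symmetric torsion $-H$. In terms of any $g$-orthonormal frame $(e_i)$, $$(H\circ_g H)(v,w)=\tfrac12\sum_{i,j}H(v,e_i,e_j)H(w,e_i,e_j),\qquad (\mathcal{R}^{g,H}\circ_g\mathcal{R}^{g,H})(v,w)=\tfrac12\sum_{i,j,k}\mathcal{R}^{g,H}_{v,e_i}(e_j,e_k)\,\mathcal{R}^{g,H}_{w,e_i}(e_j,e_k),$$ and $\langle\mathcal{R}^{g,H}\wedge\mathcal{R}^{g,H}\rangle_g=\tfrac12\sum_{i,j}\mathcal{R}^{g,H}(e_i,e_j)\wedge\mathcal{R}^{g,H}(e_i,e_j)$,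 where $\mathcal{R}^{g,H}(a,b)$ is the two-form $(u,v)\mapsto\mathcal{R}^{g,H}_{u,v}(a,b)$. A family $(g_t,H_t)_{t\in J}$ of Riemannian metrics and three-forms on $M$ is a Heterotic-Ricci flow with parameter $\kappa$ if for all $t\in J$ $$\partial_t g_t=-2\left(\mathrm{Ric}^{g_t}-\tfrac12 H_t\circ_{g_t}H_t\right)-2\kappa\,\mathcal{R}^{g_t,H_t}\circ_{g_t}\mathcal{R}^{g_t,H_t},\qquad \partial_tH_t=-\mathrm{d}\delta^{g_t}H_t,\qquad \mathrm{d}H_t+\kappa\,\langle\mathcal{R}^{g_t,H_t}\wedge\mathcal{R}^{g_t,H_t}\rangle_{g_t}=0 .$$ Proposition. Let $(g_t)_{t\in J}$ be a family of smooth Riemannian metrics on $M$ and $(f_t)_{t\in J}$ a family of smooth functions on $M$, and put $H_t=f_t\,\nu_{g_t}$, where $\nu_{g_t}$ is the Riemannian volume form. Then $(g_t,H_t)$ is a Heterotic-Ricci flow with parameter $\kappa$ if and only if for all $t\in J$ $$\begin{aligned}\partial_t g_t={}&2\kappa\,\mathrm{Ric}^{g_t}\circ\mathrm{Ric}^{g_t}-\left(2+\kappa(2s^{g_t}-f_t^2)\right)\mathrm{Ric}^{g_t}\\&+\left(f_t^2+\kappa\left((s^{g_t})^2-2|\mathrm{Ric}^{g_t}|^2_{g_t}-\tfrac12|\mathrm{d}f_t|^2_{g_t}-\tfrac14f_t^4\right)\right)g_t-\kappa\,[\ast_{g_t}\mathrm{d}f_t,\mathrm{Ric}^{g_t}]-\tfrac12\kappa\,\mathrm{d}f_t\otimes\mathrm{d}f_t\end{aligned}$$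 and $$\partial_tf_t+\tfrac12\mathrm{Tr}_{g_t}(\partial_tg_t)\,f_t+\Delta_{g_t}f_t=0 .$$ Here $\Delta_{g}=\delta^{g}\mathrm{d}$ on functions, $s^g$ is the scalar curvature, $|\mathrm{Ric}^g|_g^2=\sum_{i,j}\mathrm{Ric}^g(e_i,e_j)^2$, $(\mathrm{Ric}^g\circ\mathrm{Ric}^g)(v,w)=g(\mathrm{Ric}^g(v),\mathrm{Ric}^g(w))$, and $[\ast_g\mathrm{d}f,\mathrm{Ric}^g]$ is the commutator of the endomorphisms that correspond to $\ast_g\mathrm{d}f$ and $\mathrm{Ric}^g$ under $\alpha\mapsto(v\mapsto\alpha(v,\cdot)^{\sharp_g})$, read as a bilinear form by means of $g$. The time derivatives are taken pointwise on $M$, and their existence is part of the equations. -/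

import Mathlib

open scoped Manifold ContDiff Topology

noncomputable section

namespace HeteroticRicci

/-! ### Euclidean linear algebra

`V` is a `d`-dimensional real vector space, `B : V → V → ℝ` a Euclidean scalar product on it.
All contractions are sums over an orthonormal frame. -/

section Algebra

variable {V : Type*} [AddCommGroup V] [Module ℝ V]

/-- `e₁, …, e_d` is orthonormal for the scalar product `B`. -/
def IsOrthonormalFrame {d : ℕ} (B : V → V → ℝ) (e : Fin d → V) : Prop :=
  ∀ i j, B (e i) (e j) = if i = j then 1 else 0

/-- A chosen `B`-orthonormal frame with `d` vectors; it exists by `frame_orthonormal`. The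
contractions below do not depend on the choice. -/
def frame (d : ℕ) (B : V → V → ℝ) : Fin d → V :=
  Classical.epsilon fun e : Fin d → V => IsOrthonormalFrame B e

theorem frame_orthonormal (d : ℕ) [FiniteDimensional ℝ V] (hd : Module.finrank ℝ V = d)
    (B : V →ₗ[ℝ] V →ₗ[ℝ] ℝ) (hsymm : ∀ u v, B u v = B v u) (hpos : ∀ v, v ≠ 0 → 0 < B v v) :
    IsOrthonormalFrame (fun u v => B u v) (frame d fun u v => B u v) := by
  refine Classical.epsilon_spec (p := fun e : Fin d → V =>
    IsOrthonormalFrame (fun u v => B u v) e) ?_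
  let c : InnerProductSpace.Core ℝ V :=
    { inner := fun u v => B u v
      conj_inner_symm := fun u v => by simpa using hsymm v u
      re_inner_nonneg := fun v => by
        rcases eq_or_ne v 0 with rfl | hv
        · simp
        · simpa using (hpos v hv).le
      add_left := fun u v w => by simp
      smul_left := fun u v r => by simp
      definite := fun v hv => by
        by_contra h
        exact (hpos v h).ne' hv }
  let _ : NormedAddCommGroup V := c.toNormedAddCommGroup
  let _ : InnerProductSpace ℝ V := InnerProductSpace.ofCore c.toCore
  let b := (stdOrthonormalBasis ℝ V).reindex (finCongr hd)
  refine ⟨b, fun i j => ?_⟩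
  have h := orthonormal_iff_ite.mp b.orthonormal i j
  exact h

/-- The vector `α^♯` dual to a covector `α`. -/
def sharp (d : ℕ) (B : V → V → ℝ) (α : V → ℝ) : V :=
  ∑ i, α (frame d B i) • frame d B i

/-- The trace of a bilinear form. -/
def trace (d : ℕ) (B : V → V → ℝ) (T : V → V → ℝ) : ℝ :=
  ∑ i, T (frame d B i) (frame d B i)

/-- The squared norm of a covector. -/
def normSqCovector (d : ℕ) (B : V → V → ℝ) (α : V → ℝ) : ℝ :=
  ∑ i, α (frame d B i) ^ 2

/-- The squared norm `∑ᵢⱼ T(eᵢ, eⱼ)²` of a bilinear form. -/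
def normSqBilin (d : ℕ) (B : V → V → ℝ) (T : V → V → ℝ) : ℝ :=
  ∑ i, ∑ j, T (frame d B i) (frame d B j) ^ 2

/-- The endomorphism `v ↦ T(v, ·)^♯` attached to a bilinear form `T` by the scalar product. -/
def toEndo (d : ℕ) (B : V → V → ℝ) (T : V → V → ℝ) (v : V) : V :=
  sharp d B (T v)

/-- The bilinear form `(T ∘ T)(v, w) = B(T v, T w)`, with `T` seen as an endomorphism. -/
def bilinComp (d : ℕ) (B : V → V → ℝ) (T : V → V → ℝ) (v w : V) : ℝ :=
  B (toEndo d B T v) (toEndo d B T w)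

/-- The commutator `[S, T]` of two bilinear forms seen as endomorphisms, read again as the
bilinear form `(v, w) ↦ B([S, T] v, w)`. -/
def commutator (d : ℕ) (B : V → V → ℝ) (S T : V → V → ℝ) (v w : V) : ℝ :=
  B (toEndo d B S (toEndo d B T v) - toEndo d B T (toEndo d B S v)) w

/-- `(H ∘ H)(v, w) = ½ ∑ᵢⱼ H(v, eᵢ, eⱼ) H(w, eᵢ, eⱼ)` for a three-form `H`. -/
def threeFormComp (d : ℕ) (B : V → V → ℝ) (H : (Fin 3 → V) → ℝ) (v w : V) : ℝ :=
  1 / 2 * ∑ i, ∑ j, H ![v, frame d B i, frame d B j] * H ![w, frame d B i, frame d B j]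

/-- `(R ∘ R)(v, w) = ½ ∑ᵢⱼₖ R_{v,eᵢ}(eⱼ, eₖ) R_{w,eᵢ}(eⱼ, eₖ)` for a curvature tensor
`R u v a b = R_{u,v}(a, b)`. -/
def curvComp (d : ℕ) (B : V → V → ℝ) (R : V → V → V → V → ℝ) (v w : V) : ℝ :=
  1 / 2 * ∑ i, ∑ j, ∑ k,
    R v (frame d B i) (frame d B j) (frame d B k) * R w (frame d B i) (frame d B j) (frame d B k)

/-- The wedge product of two two-forms. -/
def wedgeTwoForms (α β : V → V → ℝ) (v : Fin 4 → V) : ℝ :=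
  α (v 0) (v 1) * β (v 2) (v 3) - α (v 0) (v 2) * β (v 1) (v 3) + α (v 0) (v 3) * β (v 1) (v 2)
    + α (v 1) (v 2) * β (v 0) (v 3) - α (v 1) (v 3) * β (v 0) (v 2) + α (v 2) (v 3) * β (v 0) (v 1)

/-- The four-form `⟨R ∧ R⟩ = ½ ∑ᵢⱼ R(eᵢ, eⱼ) ∧ R(eᵢ, eⱼ)`, where `R(a, b)` is the two-form
`(u, v) ↦ R_{u,v}(a, b)`. -/
def curvWedge (d : ℕ) (B : V → V → ℝ) (R : V → V → V → V → ℝ) (v : Fin 4 → V) : ℝ :=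
  1 / 2 * ∑ i, ∑ j, wedgeTwoForms (fun a b => R a b (frame d B i) (frame d B j))
    (fun a b => R a b (frame d B i) (frame d B j)) v

end Algebra

/-! ### Tensor calculus in a coordinate domain

`G y` is the scalar product at the point `y` of the coordinate space. Vectors of the coordinate
space stand for the corresponding constant (coordinate) vector fields, which commute. -/

/-- The coordinate space. -/
abbrev E (d : ℕ) : Type := EuclideanSpace ℝ (Fin d)

section Coordinates

variable {d : ℕ}

/-- The Levi-Civita connection `∇^g_u v` on coordinate vector fields, by the Koszul formula
`g(∇_u v, w) = ½ (u g(v, w) + v g(u, w) - w g(u, v))`. -/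
def christoffel (G : E d → E d → E d → ℝ) (y u v : E d) : E d :=
  sharp d (G y) fun w =>
    1 / 2 * (fderiv ℝ (fun z => G z v w) y u + fderiv ℝ (fun z => G z u w) y v
      - fderiv ℝ (fun z => G z u v) y w)

/-- The connection `∇^{g,H}_u v = ∇^g_u v - ½ H(u, v)^♯`, i.e. the metric connection with
totally skew-symmetric torsion `-H`, on coordinate vector fields. -/
def torsionConnection (G : E d → E d → E d → ℝ) (H : E d → (Fin 3 → E d) → ℝ) (y u v : E d) :
    E d :=
  christoffel G y u v - (1 / 2 : ℝ) • sharp d (G y) fun w => H y ![u, v, w]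

/-- The curvature `R_{u,v} w = ∇_u ∇_v w - ∇_v ∇_u w` of the connection with
`∇_u v = A y u v` on (commuting) coordinate vector fields. -/
def curvature (A : E d → E d → E d → E d) (y u v w : E d) : E d :=
  (fderiv ℝ (fun z => A z v w) y u + A y u (A y v w))
    - (fderiv ℝ (fun z => A z u w) y v + A y v (A y u w))

/-- The exterior derivative
`dη(v₀, …, v_k) = ∑ᵢ (-1)ⁱ vᵢ(η(v₀, …, v̂ᵢ, …, v_k))` on coordinate vector fields. -/
def extDer {k : ℕ} (η : E d → (Fin k → E d) → ℝ) (y : E d) (v : Fin (k + 1) → E d) : ℝ :=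
  ∑ i : Fin (k + 1), (-1 : ℝ) ^ (i : ℕ) * fderiv ℝ (fun z => η z (i.removeNth v)) y (v i)

/-- The Levi-Civita covariant derivative
`(∇_u η)(v₁, …, v_k) = u(η(v₁, …, v_k)) - ∑ⱼ η(v₁, …, ∇_u vⱼ, …, v_k)`. -/
def covDer {k : ℕ} (G : E d → E d → E d → ℝ) (η : E d → (Fin k → E d) → ℝ) (y u : E d)
    (v : Fin k → E d) : ℝ :=
  fderiv ℝ (fun z => η z v) y u
    - ∑ j : Fin k, η y (Function.update v j (christoffel G y u (v j)))

/-- The codifferential `δη = -∑ᵢ eᵢ ⌟ ∇_{eᵢ} η`. -/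
def codiff {k : ℕ} (G : E d → E d → E d → ℝ) (η : E d → (Fin (k + 1) → E d) → ℝ) (y : E d)
    (v : Fin k → E d) : ℝ :=
  -∑ i, covDer G η y (frame d (G y) i) (Fin.cons (frame d (G y) i) v)

end Coordinates

/-! ### Tensors on a manifold

The value at `x` of a tensor built from derivatives is computed in the chart at `x`. -/

section Manifold

variable {d : ℕ} {M : Type*} [TopologicalSpace M] [ChartedSpace (E d) M]

/-- The differential at `x` of the chart at `x`. -/
def toChart (x : M) : TangentSpace (𝓡 d) x →L[ℝ] E d :=
  mfderiv (𝓡 d) 𝓘(ℝ, E d) (chartAt (E d) x) x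

/-- The differential at the coordinate point `y` of the inverse of the chart at `x`. -/
def fromChart (x : M) (y : E d) : E d →L[ℝ] TangentSpace (𝓡 d) ((chartAt (E d) x).symm y) :=
  mfderiv 𝓘(ℝ, E d) (𝓡 d) (chartAt (E d) x).symm y

/-- A field of alternating `k`-forms on `M` (no regularity). -/
abbrev FormField (d : ℕ) (M : Type*) [TopologicalSpace M] [ChartedSpace (E d) M] (k : ℕ) :=
  ∀ x : M, (TangentSpace (𝓡 d) x) [⋀^Fin k]→ₗ[ℝ] ℝ

/-- The expression of a form in the chart at `x`. -/
def FormField.inChart {k : ℕ} (η : FormField d M k) (x : M) (y : E d) (v : Fin k → E d) : ℝ :=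
  η ((chartAt (E d) x).symm y) fun i => fromChart x y (v i)

/-- A form is smooth if near each point its coordinate components are smooth. -/
def FormField.IsSmooth {k : ℕ} (η : FormField d M k) : Prop :=
  ∀ (x : M) (v : Fin k → E d), ContDiffAt ℝ ∞ (fun y => η.inChart x y v) (chartAt (E d) x x)

/-- The differential of a function. -/
def differential (f : M → ℝ) (x : M) (v : TangentSpace (𝓡 d) x) : ℝ :=
  mfderiv (𝓡 d) 𝓘(ℝ, ℝ) f x v

/-- The exterior derivative of a form. -/
def FormField.exteriorDeriv {k : ℕ} (η : FormField d M k) (x : M)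
    (v : Fin (k + 1) → TangentSpace (𝓡 d) x) : ℝ :=
  extDer (η.inChart x) (chartAt (E d) x x) fun i => toChart x (v i)

variable [IsManifold (𝓡 d) ∞ M]

/-- Smooth Riemannian metrics on `M`. -/
abbrev Metric (d : ℕ) (M : Type*) [TopologicalSpace M] [ChartedSpace (E d) M]
    [IsManifold (𝓡 d) ∞ M] :=
  Bundle.ContMDiffRiemannianMetric (𝓡 d) ∞ (E d) (fun x : M => TangentSpace (𝓡 d) x)

/-- The scalar product `g_x` on `T_x M`. -/
def Metric.at (g : Metric d M) (x : M) (u v : TangentSpace (𝓡 d) x) : ℝ :=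
  g.inner x u v

/-- The expression of a metric in the chart at `x`. -/
def Metric.inChart (g : Metric d M) (x : M) (y u v : E d) : ℝ :=
  g.at ((chartAt (E d) x).symm y) (fromChart x y u) (fromChart x y v)

/-- The Riemann tensor `R^g_{u,v}(a, b) = g(R^g_{u,v} a, b)` of the Levi-Civita connection. -/
def Metric.riemann (g : Metric d M) (x : M) (u v a b : TangentSpace (𝓡 d) x) : ℝ :=
  g.inChart x (chartAt (E d) x x)
    (curvature (christoffel (g.inChart x)) (chartAt (E d) x x)
      (toChart x u) (toChart x v) (toChart x a))
    (toChart x b)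

/-- The curvature tensor `R^{g,H}_{u,v}(a, b) = g(R^{g,H}_{u,v} a, b)` of `∇^{g,H}`. -/
def Metric.torsionCurvature (g : Metric d M) (H : FormField d M 3) (x : M)
    (u v a b : TangentSpace (𝓡 d) x) : ℝ :=
  g.inChart x (chartAt (E d) x x)
    (curvature (torsionConnection (g.inChart x) (H.inChart x)) (chartAt (E d) x x)
      (toChart x u) (toChart x v) (toChart x a))
    (toChart x b)

/-- The Ricci tensor `Ric(u, v) = ∑ᵢ g(R_{eᵢ,u} v, eᵢ)`. -/
def Metric.ricci (g : Metric d M) (x : M) (u v : TangentSpace (𝓡 d) x) : ℝ :=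
  trace d (g.at x) fun a b => g.riemann x a u v b

/-- The scalar curvature. -/
def Metric.scalar (g : Metric d M) (x : M) : ℝ :=
  trace d (g.at x) (g.ricci x)

/-- `dδ^g η` for a form `η` of positive degree. -/
def Metric.dCodiff {k : ℕ} (g : Metric d M) (η : FormField d M (k + 1)) (x : M)
    (v : Fin (k + 1) → TangentSpace (𝓡 d) x) : ℝ :=
  extDer (codiff (g.inChart x) (η.inChart x)) (chartAt (E d) x x) fun i => toChart x (v i)

/-- The (non-negative) Laplace operator `Δ_g f = δ^g df` on functions. -/
def Metric.laplacian (g : Metric d M) (f : M → ℝ) (x : M) : ℝ :=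
  codiff (k := 0) (g.inChart x)
    (fun y v => fderiv ℝ (fun z => f ((chartAt (E d) x).symm z)) y (v 0))
    (chartAt (E d) x x) ![]

/-- An orientation of `M`: a choice of orientation of every tangent space which is locally
constant when read in the trivialization of the tangent bundle given by the chart at `x`. -/
structure ManifoldOrientation (d : ℕ) (M : Type*) [TopologicalSpace M] [ChartedSpace (E d) M]
    [IsManifold (𝓡 d) ∞ M] where
  /-- the orientation of `T_x M` -/
  orient : ∀ x : M, Orientation ℝ (TangentSpace (𝓡 d) x) (Fin d)
  locallyConstant : ∀ x : M, ∃ r : Orientation ℝ (E d) (Fin d), ∀ᶠ y in 𝓝 x,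
    ∃ hy : y ∈ (trivializationAt (E d) (TangentSpace (𝓡 d)) x).baseSet,
      Orientation.map (Fin d)
        ((trivializationAt (E d) (TangentSpace (𝓡 d)) x).continuousLinearEquivAt ℝ y hy).toLinearEquiv
        (orient y) = r

/-- The Riemannian volume form `ν_g`: the form in the class of the orientation which takes the
values `±1` on orthonormal frames. -/
def Metric.volumeForm (g : Metric d M) (o : ManifoldOrientation d M) : FormField d M d :=
  fun x => |(o.orient x).someVector (frame d (g.at x))|⁻¹ • (o.orient x).someVector

/-- The Hodge dual `*α = α^♯ ⌟ ν_g` of a one-form `α` on an oriented three-manifold, at `x`. -/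
def Metric.starOneForm {M : Type*} [TopologicalSpace M] [ChartedSpace (E 3) M]
    [IsManifold (𝓡 3) ∞ M] (g : Metric 3 M) (o : ManifoldOrientation 3 M) (x : M)
    (α : TangentSpace (𝓡 3) x → ℝ) (u v : TangentSpace (𝓡 3) x) : ℝ :=
  g.volumeForm o x ![sharp 3 (g.at x) α, u, v]

/-- The time derivative `∂_t g_t` at `x`, along a time interval `J`. -/
def metricDot (J : Set ℝ) (g : ℝ → Metric d M) (t : ℝ) (x : M) (u v : TangentSpace (𝓡 d) x) : ℝ :=
  derivWithin (fun s => (g s).at x u v) J t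

/-- `(g_t, H_t)`, `t ∈ J`, is a Heterotic-Ricci flow with parameter `κ`:
`∂_t g = -2 (Ric^g - ½ H ∘ H) - 2 κ R^{g,H} ∘ R^{g,H}`, `∂_t H = -dδ^g H` and
`dH + κ ⟨R^{g,H} ∧ R^{g,H}⟩ = 0`. -/
structure IsHeteroticRicciFlow (κ : ℝ) (J : Set ℝ) (g : ℝ → Metric d M)
    (H : ℝ → FormField d M 3) : Prop where
  smooth : ∀ t ∈ J, (H t).IsSmooth
  metric_eq : ∀ t ∈ J, ∀ (x : M) (u v : TangentSpace (𝓡 d) x),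
    HasDerivWithinAt (fun s => (g s).at x u v)
      (-2 * ((g t).ricci x u v - 1 / 2 * threeFormComp d ((g t).at x) (H t x) u v)
        - 2 * κ * curvComp d ((g t).at x) ((g t).torsionCurvature (H t) x) u v) J t
  torsion_eq : ∀ t ∈ J, ∀ (x : M) (v : Fin 3 → TangentSpace (𝓡 d) x),
    HasDerivWithinAt (fun s => H s x v) (-(g t).dCodiff (H t) x v) J t
  bianchi : ∀ t ∈ J, ∀ (x : M) (v : Fin 4 → TangentSpace (𝓡 d) x),
    (H t).exteriorDeriv x v + κ * curvWedge d ((g t).at x) ((g t).torsionCurvature (H t) x) v = 0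

end Manifold

end HeteroticRicci

end

/-! In dimension three a three-form `H = f ν` makes every ingredient of the flow explicit. The
connection is `∇ - ½ f ×`, where `×` is the cross product of `g` and `ν`. Since `ν`, and with it
`×`, is parallel, the curvature differs from the Riemann tensor only by terms in `df` and by the
antisymmetrised double cross product, which the vector triple product identity turns into `f²/4
(g(u,a) g(v,b) - g(v,a) g(u,b))`. This is `skewTorsionCurvature`, reached through `fderiv_density`,
`cross_cross` and `curvature_torsionConnection`.

The metric equation then becomes algebra at a point. One has `H ∘ H = f² g`, and a Riemann tensor in
dimension three has six independent components, in which the Ricci tensor is linear. On an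
orthonormal frame both right-hand sides are polynomials in these components, `f` and `df`;
`flow_metric_rhs_eq` says that they agree.

The other two equations are simpler. The constraint is empty, because `dH` and `⟨R ∧ R⟩` are
four-forms on a three-manifold. For the torsion equation, `δ(fν) = -grad f ⌟ ν`, hence `dδ(fν) =
(Δf) ν` (`extDer_codiff`); together with `∂ₜν = ½ Tr(∂ₜg) ν` (`hasDerivWithinAt_volumeForm`) the
product rule reduces it to the scalar equation for `f`.

The orthonormal frames are chosen without any regularity in the point, so they are never
differentiated. In a chart `♯` is replaced by the inverse of the metric, which is smooth, and the
volume form by `ρ η` with `η` constant and `ρ` a smooth density. Most arguments use only squares of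
volume forms, that is Gram determinants, so the orientation of a chosen frame does not matter. -/

set_option maxSynthPendingDepth 3

namespace HeteroticRicci

/-! ### Euclidean linear algebra -/

section EuclideanAlgebra

variable {V : Type*} [AddCommGroup V] [Module ℝ V] {d : ℕ} {B : V → V → ℝ} {e : Fin d → V}

/-- `B` is a Euclidean scalar product. -/
structure IsScalarProduct (B : V → V → ℝ) : Prop where
  linear : ∀ v, IsLinearMap ℝ fun u => B u v
  symm : ∀ u v, B u v = B v u
  pos : ∀ v, v ≠ 0 → 0 < B v v

/-- `Q` is bilinear. -/
structure IsBilin (Q : V → V → ℝ) : Prop where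
  left : ∀ v, IsLinearMap ℝ fun u => Q u v
  right : ∀ u, IsLinearMap ℝ fun v => Q u v

theorem IsLinearMap.sum_apply {W : Type*} [AddCommGroup W] [Module ℝ W] {α : V → W}
    (hα : IsLinearMap ℝ α) {ι : Type*} (s : Finset ι) (c : ι → ℝ) (v : ι → V) :
    α (∑ i ∈ s, c i • v i) = ∑ i ∈ s, c i • α (v i) := by
  have := map_sum (IsLinearMap.mk' α hα) (fun i => c i • v i) s
  simpa only [IsLinearMap.mk'_apply, hα.map_smul] using this

theorem IsScalarProduct.isBilin (hB : IsScalarProduct B) : IsBilin B :=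
  ⟨hB.linear, fun u => by simpa only [hB.symm u] using hB.linear u⟩

theorem IsScalarProduct.ext (hB : IsScalarProduct B) {u v : V} (h : ∀ w, B u w = B v w) :
    u = v := by
  by_contra hne
  have h1 := hB.pos (u - v) (sub_ne_zero.mpr hne)
  rw [(hB.linear (u - v)).map_sub, h, sub_self] at h1
  exact h1.false

theorem IsScalarProduct.frame (hB : IsScalarProduct B) [FiniteDimensional ℝ V]
    (hd : Module.finrank ℝ V = d) : IsOrthonormalFrame B (frame d B) := by
  let L : V →ₗ[ℝ] V →ₗ[ℝ] ℝ := LinearMap.mk₂ ℝ B (fun u v w => (hB.linear w).map_add u v)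
    (fun c u v => (hB.linear v).map_smul c u) (fun u v w => (hB.isBilin.right u).map_add v w)
    (fun c u v => (hB.isBilin.right u).map_smul c v)
  exact frame_orthonormal d hd L hB.symm hB.pos

theorem IsOrthonormalFrame.coord_sum (he : IsOrthonormalFrame B e) (hB : IsScalarProduct B)
    (c : Fin d → ℝ) (j : Fin d) : B (∑ i, c i • e i) (e j) = c j := by
  have := IsLinearMap.sum_apply (hB.linear (e j)) Finset.univ c e
  rw [this]
  simp [he _ _]

theorem IsOrthonormalFrame.expand (he : IsOrthonormalFrame B e) (hB : IsScalarProduct B)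
    [FiniteDimensional ℝ V] (hd : Module.finrank ℝ V = d) (v : V) :
    ∑ i, B v (e i) • e i = v := by
  have hli : LinearIndependent ℝ e := by
    rw [Fintype.linearIndependent_iff]
    intro c hc j
    rw [← he.coord_sum hB c j, hc]
    simpa using (hB.linear (e j)).map_zero
  have hspan := hli.span_eq_top_of_card_eq_finrank' (by simp [hd])
  obtain ⟨c, hc⟩ := (Submodule.mem_span_range_iff_exists_fun ℝ).mp
    (hspan ▸ Submodule.mem_top : v ∈ Submodule.span ℝ (Set.range e))
  rw [← hc]
  exact Finset.sum_congr rfl fun j _ => by rw [he.coord_sum hB c j]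

theorem IsOrthonormalFrame.linear_expand (he : IsOrthonormalFrame B e) (hB : IsScalarProduct B)
    [FiniteDimensional ℝ V] (hd : Module.finrank ℝ V = d)
    {W : Type*} [AddCommGroup W] [Module ℝ W] {α : V → W} (hα : IsLinearMap ℝ α) (v : V) :
    α v = ∑ i, B v (e i) • α (e i) := by
  conv_lhs => rw [← he.expand hB hd v]
  exact IsLinearMap.sum_apply hα _ _ _

theorem sharp_spec (hB : IsScalarProduct B) [FiniteDimensional ℝ V]
    (hd : Module.finrank ℝ V = d) {α : V → ℝ} (hα : IsLinearMap ℝ α) (w : V) :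
    B (sharp d B α) w = α w := by
  have he := hB.frame hd
  rw [he.linear_expand hB hd hα w, sharp]
  have := IsLinearMap.sum_apply (hB.linear w) Finset.univ (fun i => α (frame d B i)) (frame d B)
  rw [this]
  exact Finset.sum_congr rfl fun i _ => by rw [hB.symm]; simp [mul_comm]

theorem IsBilin.ext (he : IsOrthonormalFrame B e) (hB : IsScalarProduct B)
    [FiniteDimensional ℝ V] (hd : Module.finrank ℝ V = d) {Q Q' : V → V → ℝ} (hQ : IsBilin Q)
    (hQ' : IsBilin Q') (h : ∀ i j, Q (e i) (e j) = Q' (e i) (e j)) (u v : V) :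
    Q u v = Q' u v := by
  rw [he.linear_expand hB hd (hQ.left v) u, he.linear_expand hB hd (hQ'.left v) u]
  refine Finset.sum_congr rfl fun i _ => ?_
  rw [he.linear_expand hB hd (hQ.right _) v, he.linear_expand hB hd (hQ'.right _) v]
  simp only [h]

theorem IsBilin.add {Q Q' : V → V → ℝ} (h : IsBilin Q) (h' : IsBilin Q') :
    IsBilin fun u v => Q u v + Q' u v :=
  ⟨fun v => ⟨fun a b => by simp only [(h.left v).map_add, (h'.left v).map_add]; ring,
    fun a b => by simp only [(h.left v).map_smul, (h'.left v).map_smul, smul_eq_mul]; ring⟩,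
  fun v => ⟨fun a b => by simp only [(h.right v).map_add, (h'.right v).map_add]; ring,
    fun a b => by simp only [(h.right v).map_smul, (h'.right v).map_smul, smul_eq_mul]; ring⟩⟩

theorem IsBilin.const_mul {Q : V → V → ℝ} (h : IsBilin Q) (c : ℝ) :
    IsBilin fun u v => c * Q u v :=
  ⟨fun v => ⟨fun a b => by simp only [(h.left v).map_add]; ring,
    fun a b => by simp only [(h.left v).map_smul, smul_eq_mul]; ring⟩,
  fun v => ⟨fun a b => by simp only [(h.right v).map_add]; ring,
    fun a b => by simp only [(h.right v).map_smul, smul_eq_mul]; ring⟩⟩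

theorem IsBilin.sub {Q Q' : V → V → ℝ} (h : IsBilin Q) (h' : IsBilin Q') :
    IsBilin fun u v => Q u v - Q' u v := by
  simpa [sub_eq_add_neg] using h.add (h'.const_mul (-1))

theorem IsBilin.sum {ι : Type*} {s : Finset ι} {Q : ι → V → V → ℝ} (h : ∀ i, IsBilin (Q i)) :
    IsBilin fun u v => ∑ i ∈ s, Q i u v :=
  ⟨fun v => ⟨fun a b => by simp only [((h _).left v).map_add, Finset.sum_add_distrib],
    fun a b => by simp only [((h _).left v).map_smul, Finset.smul_sum]⟩,
  fun v => ⟨fun a b => by simp only [((h _).right v).map_add, Finset.sum_add_distrib],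
    fun a b => by simp only [((h _).right v).map_smul, Finset.smul_sum]⟩⟩

theorem IsBilin.of_mul {α β : V → ℝ} (hα : IsLinearMap ℝ α) (hβ : IsLinearMap ℝ β) :
    IsBilin fun u v => α u * β v :=
  ⟨fun v => ⟨fun a b => by simp only [hα.map_add]; ring,
    fun a b => by simp only [hα.map_smul, smul_eq_mul]; ring⟩,
  fun v => ⟨fun a b => by simp only [hβ.map_add]; ring,
    fun a b => by simp only [hβ.map_smul, smul_eq_mul]; ring⟩⟩

theorem IsBilin.comp {W : Type*} [AddCommGroup W] [Module ℝ W] {Q : W → W → ℝ} (h : IsBilin Q)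
    {S T : V → W} (hS : IsLinearMap ℝ S) (hT : IsLinearMap ℝ T) :
    IsBilin fun u v => Q (S u) (T v) :=
  ⟨fun v => ⟨fun a b => by rw [hS.map_add, (h.left _).map_add],
    fun a b => by rw [hS.map_smul, (h.left _).map_smul]⟩,
  fun v => ⟨fun a b => by rw [hT.map_add, (h.right _).map_add],
    fun a b => by rw [hT.map_smul, (h.right _).map_smul]⟩⟩

theorem IsBilin.toEndo {Q : V → V → ℝ} (h : IsBilin Q) : IsLinearMap ℝ (toEndo d B Q) :=
  ⟨fun a b => by
    simp only [HeteroticRicci.toEndo, sharp, (h.left _).map_add, add_smul, Finset.sum_add_distrib],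
  fun c a => by
    simp only [HeteroticRicci.toEndo, sharp, (h.left _).map_smul, Finset.smul_sum, smul_smul,
      smul_eq_mul]⟩

end EuclideanAlgebra

/-! ### Algebra in dimension three -/

section DimensionThree

variable {V : Type*} [AddCommGroup V] [Module ℝ V] {B : V → V → ℝ} {e : Fin 3 → V}

theorem alternating_linear (η : V [⋀^Fin 3]→ₗ[ℝ] ℝ) (v : Fin 3 → V) (i : Fin 3) :
    IsLinearMap ℝ fun u => η (Function.update v i u) :=
  ⟨η.map_update_add v i, η.map_update_smul v i⟩

theorem alternating_linear_left (η : V [⋀^Fin 3]→ₗ[ℝ] ℝ) (b c : V) :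
    IsLinearMap ℝ fun u => η ![u, b, c] := by
  have h := alternating_linear η ![0, b, c] 0
  have h2 : ∀ u, Function.update ![0, b, c] 0 u = ![u, b, c] := fun u => by
    ext i; fin_cases i <;> rfl
  simpa only [h2] using h

theorem alternating_linear_mid (η : V [⋀^Fin 3]→ₗ[ℝ] ℝ) (a c : V) :
    IsLinearMap ℝ fun u => η ![a, u, c] := by
  have h := alternating_linear η ![a, 0, c] 1
  have h2 : ∀ u, Function.update ![a, 0, c] 1 u = ![a, u, c] := fun u => by
    ext i; fin_cases i <;> rfl
  simpa only [h2] using h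

theorem alternating_linear_right (η : V [⋀^Fin 3]→ₗ[ℝ] ℝ) (a b : V) :
    IsLinearMap ℝ fun u => η ![a, b, u] := by
  have h := alternating_linear η ![a, b, 0] 2
  have h2 : ∀ u, Function.update ![a, b, 0] 2 u = ![a, b, u] := fun u => by
    ext i; fin_cases i <;> rfl
  simpa only [h2] using h

theorem alternating_swap_left (η : V [⋀^Fin 3]→ₗ[ℝ] ℝ) (a b c : V) :
    η ![b, a, c] = -η ![a, b, c] := by
  rw [← η.map_swap ![a, b, c] (show (0 : Fin 3) ≠ 1 by decide)]
  congr 1; ext i; fin_cases i <;> rfl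

theorem alternating_swap_right (η : V [⋀^Fin 3]→ₗ[ℝ] ℝ) (a b c : V) :
    η ![a, c, b] = -η ![a, b, c] := by
  rw [← η.map_swap ![a, b, c] (show (1 : Fin 3) ≠ 2 by decide)]
  congr 1; ext i; fin_cases i <;> rfl

theorem alternating_self_left (η : V [⋀^Fin 3]→ₗ[ℝ] ℝ) (a c : V) : η ![a, a, c] = 0 := by
  linarith [alternating_swap_left η a a c]

theorem alternating_self_right (η : V [⋀^Fin 3]→ₗ[ℝ] ℝ) (a c : V) : η ![a, c, c] = 0 := by
  linarith [alternating_swap_right η a c c]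

theorem alternating_self_outer (η : V [⋀^Fin 3]→ₗ[ℝ] ℝ) (a c : V) : η ![a, c, a] = 0 := by
  rw [alternating_swap_right, alternating_self_left, neg_zero]

omit [AddCommGroup V] [Module ℝ V] in
theorem IsOrthonormalFrame.values (he : IsOrthonormalFrame B e) :
    B (e 0) (e 0) = 1 ∧ B (e 0) (e 1) = 0 ∧ B (e 0) (e 2) = 0 ∧
    B (e 1) (e 0) = 0 ∧ B (e 1) (e 1) = 1 ∧ B (e 1) (e 2) = 0 ∧
    B (e 2) (e 0) = 0 ∧ B (e 2) (e 1) = 0 ∧ B (e 2) (e 2) = 1 := by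
  simp [he _ _]

variable [FiniteDimensional ℝ V]

/-- An alternating three-form in the coordinates of an orthonormal frame. -/
theorem alternating_eq_det (he : IsOrthonormalFrame B e) (hB : IsScalarProduct B)
    (h3 : Module.finrank ℝ V = 3) (η : V [⋀^Fin 3]→ₗ[ℝ] ℝ) (a b c : V) :
    η ![a, b, c] = η ![e 0, e 1, e 2] *
      (B a (e 0) * (B b (e 1) * B c (e 2) - B b (e 2) * B c (e 1))
        - B a (e 1) * (B b (e 0) * B c (e 2) - B b (e 2) * B c (e 0))
        + B a (e 2) * (B b (e 0) * B c (e 1) - B b (e 1) * B c (e 0))) := by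
  rw [he.linear_expand hB h3 (alternating_linear_left η b c) a]
  simp only [fun x => he.linear_expand hB h3 (alternating_linear_mid η x c) b,
    fun x y => he.linear_expand hB h3 (alternating_linear_right η x y) c, Fin.sum_univ_three,
    alternating_self_left, alternating_self_right, alternating_self_outer, smul_eq_mul]
  rw [alternating_swap_right η (e 0) (e 1) (e 2), alternating_swap_left η (e 0) (e 1) (e 2),
    alternating_swap_right η (e 1) (e 0) (e 2), alternating_swap_left η (e 0) (e 1) (e 2),
    alternating_swap_left η (e 0) (e 2) (e 1), alternating_swap_right η (e 0) (e 1) (e 2),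
    alternating_swap_right η (e 2) (e 0) (e 1), alternating_swap_left η (e 0) (e 2) (e 1),
    alternating_swap_right η (e 0) (e 1) (e 2)]
  ring

theorem scalarProduct_expand (he : IsOrthonormalFrame B e) (hB : IsScalarProduct B)
    (h3 : Module.finrank ℝ V = 3) (u v : V) :
    B u v = B u (e 0) * B v (e 0) + B u (e 1) * B v (e 1) + B u (e 2) * B v (e 2) := by
  rw [he.linear_expand hB h3 (hB.linear v) u, Fin.sum_univ_three]
  simp only [hB.symm (e _) v, smul_eq_mul]

/-- A product of two determinants is the determinant of the product, so only scalar products remain,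
and the form enters through the sign-free number `η(e)²`. -/
theorem alternating_gram (he : IsOrthonormalFrame B e) (hB : IsScalarProduct B)
    (h3 : Module.finrank ℝ V = 3) (η : V [⋀^Fin 3]→ₗ[ℝ] ℝ) (a b c a' b' c' : V) :
    η ![a, b, c] * η ![a', b', c'] = η ![e 0, e 1, e 2] ^ 2 *
      (B a a' * (B b b' * B c c' - B b c' * B c b')
        - B a b' * (B b a' * B c c' - B b c' * B c a')
        + B a c' * (B b a' * B c b' - B b b' * B c a')) := by
  rw [alternating_eq_det he hB h3 η a b c, alternating_eq_det he hB h3 η a' b' c',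
    scalarProduct_expand he hB h3 a a', scalarProduct_expand he hB h3 a b',
    scalarProduct_expand he hB h3 a c', scalarProduct_expand he hB h3 b a',
    scalarProduct_expand he hB h3 b b', scalarProduct_expand he hB h3 b c',
    scalarProduct_expand he hB h3 c a', scalarProduct_expand he hB h3 c b',
    scalarProduct_expand he hB h3 c c']
  ring

/-- The derivation of a three-form induced by an endomorphism is multiplication by its trace. -/
theorem alternating_derivation (he : IsOrthonormalFrame B e) (hB : IsScalarProduct B)
    (h3 : Module.finrank ℝ V = 3) (η : V [⋀^Fin 3]→ₗ[ℝ] ℝ) {L : V → V} (hL : IsLinearMap ℝ L)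
    (a b c : V) :
    η ![L a, b, c] + η ![a, L b, c] + η ![a, b, L c] =
      (∑ i, B (L (e i)) (e i)) * η ![a, b, c] := by
  have hc : ∀ v j, B (L v) (e j) = ∑ i, B v (e i) * B (L (e i)) (e j) := fun v j => by
    have h : IsLinearMap ℝ fun v => B (L v) (e j) :=
      ⟨fun x y => by rw [hL.map_add, (hB.linear _).map_add],
        fun r x => by rw [hL.map_smul, (hB.linear _).map_smul]⟩
    exact he.linear_expand hB h3 h v
  rw [alternating_eq_det he hB h3 η (L a), alternating_eq_det he hB h3 η a (L b),
    alternating_eq_det he hB h3 η a b (L c), alternating_eq_det he hB h3 η a b c]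
  simp only [hc a, hc b, hc c, Fin.sum_univ_three]
  ring

/-- `α ∧ η = 0` for a covector and a three-form in dimension three. -/
theorem covector_wedge_alternating (he : IsOrthonormalFrame B e) (hB : IsScalarProduct B)
    (h3 : Module.finrank ℝ V = 3) (η : V [⋀^Fin 3]→ₗ[ℝ] ℝ) {α : V → ℝ} (hα : IsLinearMap ℝ α)
    (a b c x : V) :
    α a * η ![b, c, x] - α b * η ![a, c, x] + α c * η ![a, b, x] - α x * η ![a, b, c] = 0 := by
  rw [alternating_eq_det he hB h3 η b c x, alternating_eq_det he hB h3 η a c x,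
    alternating_eq_det he hB h3 η a b x, alternating_eq_det he hB h3 η a b c]
  simp only [he.linear_expand hB h3 hα a, he.linear_expand hB h3 hα b,
    he.linear_expand hB h3 hα c, he.linear_expand hB h3 hα x, Fin.sum_univ_three, smul_eq_mul]
  ring

/-- `α ∧ α = 0` for a two-form in dimension three. -/
theorem wedgeTwoForms_self (he : IsOrthonormalFrame B e) (hB : IsScalarProduct B)
    (h3 : Module.finrank ℝ V = 3) {α : V → V → ℝ} (hα : ∀ v, IsLinearMap ℝ fun u => α u v)
    (hanti : ∀ u v, α u v = -α v u) (v : Fin 4 → V) : wedgeTwoForms α α v = 0 := by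
  have h0 : ∀ u, α u u = 0 := fun u => by linarith [hanti u u]
  have hr : ∀ u, IsLinearMap ℝ fun v => α u v := fun u => by
    simp only [hanti u]
    exact ⟨fun a b => by rw [(hα u).map_add]; ring,
      fun c a => by rw [(hα u).map_smul, smul_eq_mul, smul_eq_mul]; ring⟩
  -- A two-form has three coordinates on `eⁱ ∧ eʲ`, `i < j`; in these, the vanishing of `α ∧ α` is a
  -- polynomial identity.
  have key : ∀ u v, α u v = (B u (e 0) * B v (e 1) - B u (e 1) * B v (e 0)) * α (e 0) (e 1)
      + (B u (e 0) * B v (e 2) - B u (e 2) * B v (e 0)) * α (e 0) (e 2)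
      + (B u (e 1) * B v (e 2) - B u (e 2) * B v (e 1)) * α (e 1) (e 2) := fun u v => by
    rw [he.linear_expand hB h3 (hα v) u]
    simp only [fun x => he.linear_expand hB h3 (hr x) v, Fin.sum_univ_three, h0, smul_eq_mul,
      hanti (e 1) (e 0), hanti (e 2) (e 0), hanti (e 2) (e 1)]
    ring
  simp only [wedgeTwoForms, key (v _) (v _)]
  ring

/-- The vector triple product identity. The cross product enters twice, so `η(e) = ±1` suffices and
the orientation of the frame is irrelevant. -/
theorem cross_cross (he : IsOrthonormalFrame B e) (hB : IsScalarProduct B)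
    (h3 : Module.finrank ℝ V = 3) (η : V [⋀^Fin 3]→ₗ[ℝ] ℝ) (hη : η ![e 0, e 1, e 2] ^ 2 = 1)
    {C : V → V → V} (hC : ∀ u v w, B (C u v) w = η ![u, v, w]) (u v a b : V) :
    B (C u (C v a)) b = B u a * B v b - B u v * B a b := by
  -- Skew-symmetry moves one product to the other side, giving `-B(u × b, v × a)`; what remains is
  -- Lagrange's identity in frame coordinates.
  rw [hC, alternating_swap_right, ← hC, scalarProduct_expand he hB h3 (C u b), hC, hC, hC, hC, hC,
    hC, scalarProduct_expand he hB h3 u a, scalarProduct_expand he hB h3 v b,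
    scalarProduct_expand he hB h3 u v, scalarProduct_expand he hB h3 a b]
  obtain ⟨h00, h01, h02, h10, h11, h12, h20, h21, h22⟩ := he.values
  rw [alternating_eq_det he hB h3 η u b (e 0), alternating_eq_det he hB h3 η u b (e 1),
    alternating_eq_det he hB h3 η u b (e 2), alternating_eq_det he hB h3 η v a (e 0),
    alternating_eq_det he hB h3 η v a (e 1), alternating_eq_det he hB h3 η v a (e 2)]
  simp only [h00, h01, h02, h10, h11, h12, h20, h21, h22]
  linear_combination (norm := ring) (-((B u (e 1) * B b (e 2) - B u (e 2) * B b (e 1)) *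
    (B v (e 1) * B a (e 2) - B v (e 2) * B a (e 1)) +
    (B u (e 0) * B b (e 2) - B u (e 2) * B b (e 0)) *
    (B v (e 0) * B a (e 2) - B v (e 2) * B a (e 0)) +
    (B u (e 0) * B b (e 1) - B u (e 1) * B b (e 0)) *
    (B v (e 0) * B a (e 1) - B v (e 1) * B a (e 0)))) * hη

end DimensionThree

/-! ### Curvature tensors -/

section CurvatureTensor

variable {V : Type*} [AddCommGroup V] [Module ℝ V] {B : V → V → ℝ}

/-- The algebraic properties of a Riemann tensor. -/
structure IsCurvatureTensor (R : V → V → V → V → ℝ) : Prop where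
  linear : ∀ v a b, IsLinearMap ℝ fun u => R u v a b
  linear' : ∀ u v b, IsLinearMap ℝ fun a => R u v a b
  antisymm : ∀ u v a b, R v u a b = -R u v a b
  antisymm' : ∀ u v a b, R u v b a = -R u v a b
  bianchi : ∀ u v a b, R u v a b + R v a u b + R a u v b = 0

/-- The octahedron argument: the four Bianchi identities obtained by cycling `u, v, a, b` combine,
and the two antisymmetries cancel all other terms. -/
theorem IsCurvatureTensor.pair_symm {R : V → V → V → V → ℝ} (hR : IsCurvatureTensor R)
    (u v a b : V) : R a b u v = R u v a b := by
  linarith [hR.bianchi u v a b, hR.bianchi v a b u, hR.bianchi a b u v, hR.bianchi b u v a,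
    hR.antisymm u v a b, hR.antisymm v a u b, hR.antisymm a u v b, hR.antisymm v a b u,
    hR.antisymm a b v u, hR.antisymm b v a u, hR.antisymm a b u v, hR.antisymm b u a v,
    hR.antisymm u a b v, hR.antisymm b u v a, hR.antisymm u v b a, hR.antisymm v b u a,
    hR.antisymm' u v a b, hR.antisymm' v a u b, hR.antisymm' a u v b, hR.antisymm' a b u v,
    hR.antisymm' b v a u, hR.antisymm' b u v a, hR.antisymm' u a b v, hR.antisymm' v b u a,
    hR.antisymm' u a v b, hR.antisymm' v b a u]

/-- The curvature of the connection with torsion `-φ ν` on a three-manifold, in terms of the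
Riemann tensor `R`, the function `φ`, its differential `α` and the volume form `η`. -/
noncomputable def skewTorsionCurvature (B : V → V → ℝ) (R : V → V → V → V → ℝ) (η : V [⋀^Fin 3]→ₗ[ℝ] ℝ)
    (φ : ℝ) (α : V → ℝ) (u v a b : V) : ℝ :=
  R u v a b - 1 / 2 * α u * η ![v, a, b] + 1 / 2 * α v * η ![u, a, b]
    + φ ^ 2 / 4 * (B u a * B v b - B v a * B u b)

theorem skewTorsionCurvature_linear (hB : IsScalarProduct B) {R : V → V → V → V → ℝ}
    (hR : IsCurvatureTensor R) (η : V [⋀^Fin 3]→ₗ[ℝ] ℝ) (φ : ℝ) {α : V → ℝ}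
    (hα : IsLinearMap ℝ α) (v a b : V) :
    IsLinearMap ℝ fun u => skewTorsionCurvature B R η φ α u v a b :=
  ⟨fun x y => by
    simp only [skewTorsionCurvature, (hR.linear _ _ _).map_add, hα.map_add, (hB.linear _).map_add,
      (alternating_linear_left η _ _).map_add]
    ring,
  fun c x => by
    simp only [skewTorsionCurvature, (hR.linear _ _ _).map_smul, hα.map_smul,
      (hB.linear _).map_smul, (alternating_linear_left η _ _).map_smul, smul_eq_mul]
    ring⟩

theorem skewTorsionCurvature_antisymm {R : V → V → V → V → ℝ} (hR : IsCurvatureTensor R)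
    (η : V [⋀^Fin 3]→ₗ[ℝ] ℝ) (φ : ℝ) (α : V → ℝ) (u v a b : V) :
    skewTorsionCurvature B R η φ α u v a b = -skewTorsionCurvature B R η φ α v u a b := by
  simp only [skewTorsionCurvature, hR.antisymm u v]
  ring

theorem IsCurvatureTensor.ricci_isBilin {R : V → V → V → V → ℝ} (hR : IsCurvatureTensor R) :
    IsBilin fun u v => trace 3 B fun a b => R a u v b := by
  refine IsBilin.sum (Q := fun i u v => R (frame 3 B i) u v (frame 3 B i)) fun i =>
    ⟨fun v => ?_, fun u => hR.linear' _ _ _⟩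
  simp only [hR.antisymm _ (frame 3 B i)]
  exact ⟨fun a b => by rw [(hR.linear _ _ _).map_add]; ring,
      fun c a => by rw [(hR.linear _ _ _).map_smul, smul_eq_mul, smul_eq_mul]; ring⟩

end CurvatureTensor

/-! ### The metric equation as an algebraic identity at a point -/

section FlowAlgebra

variable {V : Type*} [AddCommGroup V] [Module ℝ V] {B : V → V → ℝ}
  {R : V → V → V → V → ℝ} {η : V [⋀^Fin 3]→ₗ[ℝ] ℝ} {α : V → ℝ}

theorem star_isBilin (η : V [⋀^Fin 3]→ₗ[ℝ] ℝ) (x : V) : IsBilin fun u v => η ![x, u, v] :=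
  ⟨fun v => alternating_linear_mid η x v, fun u => alternating_linear_right η x u⟩

theorem IsBilin.bilinComp (hB : IsScalarProduct B) {T : V → V → ℝ} (hT : IsBilin T) :
    IsBilin (bilinComp 3 B T) :=
  hB.isBilin.comp hT.toEndo hT.toEndo

theorem IsBilin.commutator (hB : IsScalarProduct B) {S T : V → V → ℝ} (hS : IsBilin S)
    (hT : IsBilin T) : IsBilin (commutator 3 B S T) := by
  refine hB.isBilin.comp ⟨fun a b => ?_, fun c a => ?_⟩ ⟨fun _ _ => rfl, fun _ _ => rfl⟩
  · rw [hT.toEndo.map_add, hS.toEndo.map_add, hS.toEndo.map_add, hT.toEndo.map_add]; abel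
  · rw [hT.toEndo.map_smul, hS.toEndo.map_smul, hS.toEndo.map_smul, hT.toEndo.map_smul, smul_sub]

theorem curvComp_isBilin (h : ∀ v a b, IsLinearMap ℝ fun u => R u v a b) :
    IsBilin (curvComp 3 B R) :=
  (IsBilin.sum fun _ => IsBilin.sum fun _ => IsBilin.sum fun _ =>
    IsBilin.of_mul (h _ _ _) (h _ _ _)).const_mul _

theorem threeFormComp_isBilin (η : V [⋀^Fin 3]→ₗ[ℝ] ℝ) : IsBilin (threeFormComp 3 B η) :=
  (IsBilin.sum fun _ => IsBilin.sum fun _ => IsBilin.of_mul (alternating_linear_left η _ _)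
    (alternating_linear_left η _ _)).const_mul _

theorem skewTorsionCurvature_antisymm' (hR : IsCurvatureTensor R)
    (η : V [⋀^Fin 3]→ₗ[ℝ] ℝ) (φ : ℝ) (α : V → ℝ) (u v a b : V) :
    skewTorsionCurvature B R η φ α u v b a = -skewTorsionCurvature B R η φ α u v a b := by
  simp only [skewTorsionCurvature, hR.antisymm' u v a b, alternating_swap_right η _ a b]
  ring

-- Antisymmetry in the last pair cancels the factor `½` against the double count of each pair of
-- indices.
omit [Module ℝ V] in
theorem curvComp_eq {S : V → V → V → V → ℝ} (hS : ∀ u v a b, S u v b a = -S u v a b)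
    (u v : V) {e : Fin 3 → V} (he : frame 3 B = e) : curvComp 3 B S u v =
      ∑ i, (S u (e i) (e 0) (e 1) * S v (e i) (e 0) (e 1)
        + S u (e i) (e 0) (e 2) * S v (e i) (e 0) (e 2)
        + S u (e i) (e 1) (e 2) * S v (e i) (e 1) (e 2)) := by
  have h0 : ∀ u v a, S u v a a = 0 := fun u v a => by linarith [hS u v a a]
  rw [curvComp, he, Finset.mul_sum]
  refine Finset.sum_congr rfl fun i _ => ?_
  simp only [Fin.sum_univ_three, h0, hS _ _ (e 0) (e 1), hS _ _ (e 0) (e 2), hS _ _ (e 1) (e 2)]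
  ring

theorem threeFormComp_eq (hB : IsScalarProduct B) {e : Fin 3 → V} (he : IsOrthonormalFrame B e)
    [FiniteDimensional ℝ V] (h3 : Module.finrank ℝ V = 3) (hf : frame 3 B = e)
    (hη : η ![e 0, e 1, e 2] ^ 2 = 1) (φ : ℝ) (u v : V) :
    threeFormComp 3 B ⇑(φ • η) u v = φ ^ 2 * B u v := by
  have h := fun i j => alternating_gram he hB h3 η u (e i) (e j) v (e i) (e j)
  simp only [hη, one_mul] at h
  simp only [threeFormComp, hf, AlternatingMap.smul_apply, smul_eq_mul,
    mul_mul_mul_comm φ _ φ, h]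
  obtain ⟨h00, h01, h02, h10, h11, h12, h20, h21, h22⟩ := he.values
  simp only [Fin.sum_univ_three, h00, h01, h02, h10, h11, h12, h20, h21, h22,
    scalarProduct_expand he hB h3 u v, hB.symm (e _) v]
  ring

variable [FiniteDimensional ℝ V]

theorem toEndo_apply (hB : IsScalarProduct B) (h3 : Module.finrank ℝ V = 3) {T : V → V → ℝ}
    (hT : IsBilin T) (v w : V) : B (toEndo 3 B T v) w = T v w :=
  sharp_spec hB h3 (hT.right v) w

theorem bilinComp_eq (hB : IsScalarProduct B) (h3 : Module.finrank ℝ V = 3) {T : V → V → ℝ}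
    (hT : IsBilin T) (v w : V) :
    bilinComp 3 B T v w = ∑ i, T v (frame 3 B i) * T w (frame 3 B i) := by
  rw [bilinComp, scalarProduct_expand (hB.frame h3) hB h3, Fin.sum_univ_three]
  simp only [toEndo_apply hB h3 hT]

theorem commutator_eq (hB : IsScalarProduct B) (h3 : Module.finrank ℝ V = 3)
    {S T : V → V → ℝ} (hS : IsBilin S) (hT : IsBilin T) (v w : V) :
    commutator 3 B S T v w = ∑ i, (T v (frame 3 B i) * S (frame 3 B i) w
      - S v (frame 3 B i) * T (frame 3 B i) w) := by
  rw [commutator, (hB.linear w).map_sub, toEndo_apply hB h3 hS, toEndo_apply hB h3 hT,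
    (hB.frame h3).linear_expand hB h3 (hS.left w), (hB.frame h3).linear_expand hB h3 (hT.left w),
    ← Finset.sum_sub_distrib]
  simp only [toEndo_apply hB h3 hS, toEndo_apply hB h3 hT, smul_eq_mul]

-- The comparison by components, with every contraction already written as a frame sum. Both sides
-- become polynomials in the six components of `R`, the three of `α`, `φ` and the sign `η(e)`.
set_option linter.unusedSimpArgs false in
theorem flow_metric_rhs_eq_on_frame (hB : IsScalarProduct B) (h3 : Module.finrank ℝ V = 3)
    (hR : IsCurvatureTensor R) {e : Fin 3 → V} (he : IsOrthonormalFrame B e)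
    (hf : frame 3 B = e) (hη' : η ![e 0, e 1, e 2] ^ 2 = 1) (κ φ : ℝ)
    {Ric : V → V → ℝ} (hRic : Ric = fun u v => trace 3 B fun a b => R a u v b) (i j : Fin 3) :
    -2 * (Ric (e i) (e j) - 1 / 2 * threeFormComp 3 B ⇑(φ • η) (e i) (e j))
        - 2 * κ * curvComp 3 B (skewTorsionCurvature B R η φ α) (e i) (e j) =
      2 * κ * ∑ k, Ric (e i) (e k) * Ric (e j) (e k)
        - (2 + κ * (2 * trace 3 B Ric - φ ^ 2)) * Ric (e i) (e j)
        + (φ ^ 2 + κ * (trace 3 B Ric ^ 2 - 2 * normSqBilin 3 B Ric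
            - 1 / 2 * normSqCovector 3 B α - 1 / 4 * φ ^ 4)) * B (e i) (e j)
        - κ * ∑ k, (Ric (e i) (e k) * ∑ l, α (e l) * η ![e l, e k, e j]
            - (∑ l, α (e l) * η ![e l, e i, e k]) * Ric (e k) (e j))
        - 1 / 2 * κ * (α (e i) * α (e j)) := by
  simp only [threeFormComp_eq hB he h3 hf hη',
    curvComp_eq (skewTorsionCurvature_antisymm' hR η φ α) _ _ hf]
  obtain ⟨h00, h01, h02, h10, h11, h12, h20, h21, h22⟩ := he.values
  have z1 : ∀ u a b, R u u a b = 0 := fun u a b => by linarith [hR.antisymm u u a b]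
  have z2 : ∀ u v a, R u v a a = 0 := fun u v a => by linarith [hR.antisymm' u v a a]
  have s1 := hR.antisymm (e 0) (e 1)
  have s2 := hR.antisymm (e 0) (e 2)
  have s3 := hR.antisymm (e 1) (e 2)
  have t1 := fun u v => hR.antisymm' u v (e 0) (e 1)
  have t2 := fun u v => hR.antisymm' u v (e 0) (e 2)
  have t3 := fun u v => hR.antisymm' u v (e 1) (e 2)
  -- Pair symmetry identifies the mixed components, leaving six.
  have p1 := hR.pair_symm (e 0) (e 1) (e 0) (e 2)
  have p2 := hR.pair_symm (e 0) (e 1) (e 1) (e 2)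
  have p3 := hR.pair_symm (e 0) (e 2) (e 1) (e 2)
  have o1 := alternating_swap_right η (e 0) (e 1) (e 2)
  have o2 := alternating_swap_left η (e 0) (e 1) (e 2)
  have o3 : η ![e 1, e 2, e 0] = η ![e 0, e 1, e 2] := by
    rw [alternating_swap_right, alternating_swap_left, neg_neg]
  have o4 : η ![e 2, e 0, e 1] = η ![e 0, e 1, e 2] := by
    rw [alternating_swap_left, alternating_swap_right, neg_neg]
  have o5 : η ![e 2, e 1, e 0] = -η ![e 0, e 1, e 2] := by
    rw [alternating_swap_right, o4]
  have y1 := alternating_self_left η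
  have y2 := alternating_self_right η
  have y3 := alternating_self_outer η
  -- The minus signs come from the convention `R_{u,v}(a, b) = g(R_{u,v} a, b)`, for which `R(u, v,
  -- u, v)` is minus the sectional curvature on an orthonormal pair.
  have a00 : Ric (e 0) (e 0) = -R (e 0) (e 1) (e 0) (e 1) - R (e 0) (e 2) (e 0) (e 2) := by
    simp only [hRic, trace, hf, Fin.sum_univ_three, z1, z2, s1, s2, s3, t1, t2, t3]; ring
  have a11 : Ric (e 1) (e 1) = -R (e 0) (e 1) (e 0) (e 1) - R (e 1) (e 2) (e 1) (e 2) := by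
    simp only [hRic, trace, hf, Fin.sum_univ_three, z1, z2, s1, s2, s3, t1, t2, t3]; ring
  have a22 : Ric (e 2) (e 2) = -R (e 0) (e 2) (e 0) (e 2) - R (e 1) (e 2) (e 1) (e 2) := by
    simp only [hRic, trace, hf, Fin.sum_univ_three, z1, z2, s1, s2, s3, t1, t2, t3]; ring
  have a01 : Ric (e 0) (e 1) = -R (e 0) (e 2) (e 1) (e 2) := by
    simp only [hRic, trace, hf, Fin.sum_univ_three, z1, z2, s1, s2, s3, t1, t2, t3]; ring
  have a10 : Ric (e 1) (e 0) = -R (e 0) (e 2) (e 1) (e 2) := by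
    simp only [hRic, trace, hf, Fin.sum_univ_three, z1, z2, s1, s2, s3, t1, t2, t3, p3]; ring
  have a02 : Ric (e 0) (e 2) = R (e 0) (e 1) (e 1) (e 2) := by
    simp only [hRic, trace, hf, Fin.sum_univ_three, z1, z2, s1, s2, s3, t1, t2, t3]; ring
  have a20 : Ric (e 2) (e 0) = R (e 0) (e 1) (e 1) (e 2) := by
    simp only [hRic, trace, hf, Fin.sum_univ_three, z1, z2, s1, s2, s3, t1, t2, t3, p2]; ring
  have a12 : Ric (e 1) (e 2) = -R (e 0) (e 1) (e 0) (e 2) := by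
    simp only [hRic, trace, hf, Fin.sum_univ_three, z1, z2, s1, s2, s3, t1, t2, t3]; ring
  have a21 : Ric (e 2) (e 1) = -R (e 0) (e 1) (e 0) (e 2) := by
    simp only [hRic, trace, hf, Fin.sum_univ_three, z1, z2, s1, s2, s3, t1, t2, t3, p1]; ring
  have hd : ∀ u a b, skewTorsionCurvature B R η φ α u u a b = 0 := fun u a b => by
    linarith [skewTorsionCurvature_antisymm (B := B) hR η φ α u u a b]
  have f1 := skewTorsionCurvature_antisymm (B := B) hR η φ α (e 1) (e 0)
  have f2 := skewTorsionCurvature_antisymm (B := B) hR η φ α (e 2) (e 0)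
  have f3 := skewTorsionCurvature_antisymm (B := B) hR η φ α (e 2) (e 1)
  have g : ∀ i j k l, skewTorsionCurvature B R η φ α (e i) (e j) (e k) (e l) =
    R (e i) (e j) (e k) (e l) - 1 / 2 * α (e i) * η ![e j, e k, e l]
      + 1 / 2 * α (e j) * η ![e i, e k, e l]
      + φ ^ 2 / 4 * (B (e i) (e k) * B (e j) (e l) - B (e j) (e k) * B (e i) (e l)) :=
    fun i j k l => rfl
  have hs : trace 3 B Ric = -2 * (R (e 0) (e 1) (e 0) (e 1) + R (e 0) (e 2) (e 0) (e 2)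
      + R (e 1) (e 2) (e 1) (e 2)) := by
    simp only [trace, hf, Fin.sum_univ_three, a00, a11, a22]; ring
  clear hRic
  -- The frame may be positively or negatively oriented. The commutator with `*df` is odd in this
  -- sign, so both values are inserted before comparing polynomials.
  have hσ := sq_eq_one_iff.mp hη'
  simp only [hs, normSqBilin, normSqCovector, hf, Fin.sum_univ_three]
  fin_cases i <;> fin_cases j <;>
  simp only [Fin.zero_eta, Fin.mk_one, Fin.reduceFinMk, hd, f1, f2, f3, g, a00, a01, a02, a10,
    a11, a12, a20, a21, a22, h00, h01, h02, h10, h11, h12, h20, h21, h22, p1, p2, p3, o1, o2, o3,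
    o4, o5, y1, y2, y3] <;>
  rcases hσ with hσ | hσ <;> simp only [hσ] <;> ring

/-- The right-hand side of the metric equation of the Heterotic-Ricci flow with `H = φ η`,
in terms of the Ricci tensor. -/
theorem flow_metric_rhs_eq (hB : IsScalarProduct B) (h3 : Module.finrank ℝ V = 3)
    (hR : IsCurvatureTensor R) (hη : η (frame 3 B) ^ 2 = 1) (κ φ : ℝ) (hα : IsLinearMap ℝ α)
    {Ric : V → V → ℝ} (hRic : Ric = fun u v => trace 3 B fun a b => R a u v b) (u v : V) :
    -2 * (Ric u v - 1 / 2 * threeFormComp 3 B ⇑(φ • η) u v)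
        - 2 * κ * curvComp 3 B (skewTorsionCurvature B R η φ α) u v =
      2 * κ * bilinComp 3 B Ric u v
        - (2 + κ * (2 * trace 3 B Ric - φ ^ 2)) * Ric u v
        + (φ ^ 2 + κ * (trace 3 B Ric ^ 2 - 2 * normSqBilin 3 B Ric
            - 1 / 2 * normSqCovector 3 B α - 1 / 4 * φ ^ 4)) * B u v
        - κ * commutator 3 B (fun u v => η ![sharp 3 B α, u, v]) Ric u v
        - 1 / 2 * κ * (α u * α v) := by
  have he := hB.frame h3
  have hRicB : IsBilin Ric := by rw [hRic]; exact hR.ricci_isBilin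
  have hstar := star_isBilin η (sharp 3 B α)
  refine IsBilin.ext he hB h3
    (Q := fun u v => -2 * (Ric u v - 1 / 2 * threeFormComp 3 B ⇑(φ • η) u v)
        - 2 * κ * curvComp 3 B (skewTorsionCurvature B R η φ α) u v)
    (Q' := fun u v => 2 * κ * bilinComp 3 B Ric u v
        - (2 + κ * (2 * trace 3 B Ric - φ ^ 2)) * Ric u v
        + (φ ^ 2 + κ * (trace 3 B Ric ^ 2 - 2 * normSqBilin 3 B Ric
            - 1 / 2 * normSqCovector 3 B α - 1 / 4 * φ ^ 4)) * B u v
        - κ * commutator 3 B (fun u v => η ![sharp 3 B α, u, v]) Ric u v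
        - 1 / 2 * κ * (α u * α v))
    (((hRicB.sub ((threeFormComp_isBilin _).const_mul _)).const_mul _).sub
      ((curvComp_isBilin (skewTorsionCurvature_linear hB hR η φ hα)).const_mul _))
    ((((((IsBilin.bilinComp hB hRicB).const_mul _).sub (hRicB.const_mul _)).add
      (hB.isBilin.const_mul _)).sub ((IsBilin.commutator hB hstar hRicB).const_mul _)).sub
      ((IsBilin.of_mul hα hα).const_mul _)) ?_ u v
  have hs : ∀ u v, η ![sharp 3 B α, u, v] = ∑ i, α (frame 3 B i) * η ![frame 3 B i, u, v] :=
    fun u v => IsLinearMap.sum_apply (alternating_linear_left η u v) _ _ _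
  simp only [bilinComp_eq hB h3 hRicB, commutator_eq hB h3 hstar hRicB]
  simp only [hs]
  generalize hf : frame 3 B = e at *
  have hη' : η ![e 0, e 1, e 2] ^ 2 = 1 := by
    rw [← hη]; congr 2; ext i; fin_cases i <;> rfl
  exact flow_metric_rhs_eq_on_frame hB h3 hR he hf hη' κ φ hRic

end FlowAlgebra

/-! ### The Levi-Civita connection in a coordinate domain -/

section LocalMetric

variable {d : ℕ} {B : E d → E d →L[ℝ] E d →L[ℝ] ℝ} {U : Set (E d)} {y : E d}

/-- `B` is a smooth Riemannian metric on the open set `U`. -/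
structure IsLocalMetric (B : E d → E d →L[ℝ] E d →L[ℝ] ℝ) (U : Set (E d)) : Prop where
  isOpen : IsOpen U
  contDiffOn : ContDiffOn ℝ ∞ B U
  scalar : ∀ y ∈ U, IsScalarProduct fun u v => B y u v

theorem finrank_E : Module.finrank ℝ (E d) = d := finrank_euclideanSpace_fin

theorem fderiv_apply₂ {F : Type*} [NormedAddCommGroup F] [NormedSpace ℝ F]
    {A : E d → E d →L[ℝ] E d →L[ℝ] F} (hA : DifferentiableAt ℝ A y) (v w u : E d) :
    fderiv ℝ (fun z => A z v w) y u = fderiv ℝ A y u v w := by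
  have h := (hA.hasFDerivAt.clm_apply (hasFDerivAt_const v y)).clm_apply (hasFDerivAt_const w y)
  rw [h.fderiv]
  simp

theorem differentiableAt_of_contDiffOn {F : Type*} [NormedAddCommGroup F]
    [NormedSpace ℝ F] {f : E d → F} (hf : ContDiffOn ℝ ∞ f U) (hU : IsOpen U) (hy : y ∈ U) :
    DifferentiableAt ℝ f y :=
  (hf.contDiffAt (hU.mem_nhds hy)).differentiableAt (by simp)

namespace IsLocalMetric

variable (hB : IsLocalMetric B U)
include hB

theorem differentiableAt (hy : y ∈ U) : DifferentiableAt ℝ B y :=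
  differentiableAt_of_contDiffOn hB.contDiffOn hB.isOpen hy

/-- Positivity gives injectivity, and `sharp` provides preimages. -/
theorem isInvertible (hy : y ∈ U) : (B y).IsInvertible := by
  have h := hB.scalar y hy
  refine ⟨ContinuousLinearEquiv.ofBijective (B y) ?_ ?_, ContinuousLinearEquiv.coe_ofBijective _ _ _⟩
  · rw [LinearMap.ker_eq_bot]
    exact fun u v huv => h.ext fun w => congrArg (fun α : E d →L[ℝ] ℝ => α w) huv
  · rw [LinearMap.range_eq_top]
    exact fun α => ⟨sharp d (fun u v => B y u v) α, ContinuousLinearMap.ext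
      (sharp_spec h finrank_E ⟨α.map_add, α.map_smul⟩)⟩

theorem apply_inverse (hy : y ∈ U) (α : E d →L[ℝ] ℝ) (w : E d) :
    B y ((B y).inverse α) w = α w := by
  rw [(hB.isInvertible hy).self_apply_inverse]

/-- The frame inside `sharp` depends on `y` through an arbitrary choice. The inverse of `B y` is the
same map in a form whose smoothness follows from that of inversion. -/
theorem sharp_eq (hy : y ∈ U) (α : E d →L[ℝ] ℝ) :
    sharp d (fun u v => B y u v) (fun w => α w) = (B y).inverse α :=
  (hB.scalar y hy).ext fun w => by
    rw [hB.apply_inverse hy]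
    exact sharp_spec (hB.scalar y hy) finrank_E ⟨α.map_add, α.map_smul⟩ w

theorem contDiffOn_inverse : ContDiffOn ℝ ∞ (fun y => (B y).inverse) U := fun y hy =>
  ((hB.isInvertible hy).contDiffAt_map_inverse).comp_contDiffWithinAt y (hB.contDiffOn y hy)

theorem contDiffOn_fderiv : ContDiffOn ℝ ∞ (fderiv ℝ B) U :=
  hB.contDiffOn.fderiv_of_isOpen hB.isOpen (by simp)

theorem fderiv_symm (hy : y ∈ U) (u v w : E d) : fderiv ℝ B y u v w = fderiv ℝ B y u w v := by
  rw [← fderiv_apply₂ (hB.differentiableAt hy), ← fderiv_apply₂ (hB.differentiableAt hy)]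
  have : (fun z => B z v w) =ᶠ[𝓝 y] fun z => B z w v := by
    filter_upwards [hB.isOpen.mem_nhds hy] with z hz using (hB.scalar z hz).symm v w
  rw [this.fderiv_eq]

end IsLocalMetric

/-- The Christoffel symbols of the first kind, as a trilinear form. -/
noncomputable def koszulForm (B : E d → E d →L[ℝ] E d →L[ℝ] ℝ) (y : E d) :
    E d →L[ℝ] E d →L[ℝ] E d →L[ℝ] ℝ :=
  (1 / 2 : ℝ) • (fderiv ℝ B y + (fderiv ℝ B y).flip
    - ((ContinuousLinearMap.flipₗᵢ ℝ (E d) (E d) ℝ).toContinuousLinearEquiv.toContinuousLinearMap ∘L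
        (fderiv ℝ B y).flip))

theorem koszulForm_apply (u v w : E d) : koszulForm B y u v w =
    1 / 2 * (fderiv ℝ B y u v w + fderiv ℝ B y v u w - fderiv ℝ B y w u v) := by
  simp [koszulForm]

/-- The Levi-Civita connection of `B` as a bilinear map. -/
noncomputable def leviCivita (B : E d → E d →L[ℝ] E d →L[ℝ] ℝ) (y : E d) :
    E d →L[ℝ] E d →L[ℝ] E d :=
  (ContinuousLinearMap.compL ℝ (E d) (E d →L[ℝ] ℝ) (E d) (B y).inverse) ∘L koszulForm B y

theorem leviCivita_apply (u v : E d) :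
    leviCivita B y u v = (B y).inverse (koszulForm B y u v) := rfl

namespace IsLocalMetric

variable (hB : IsLocalMetric B U)
include hB

theorem christoffel_eq (hy : y ∈ U) (u v : E d) :
    christoffel (fun y u v => B y u v) y u v = leviCivita B y u v := by
  rw [leviCivita_apply, ← hB.sharp_eq hy, christoffel]
  congr 1
  ext w
  rw [koszulForm_apply, fderiv_apply₂ (hB.differentiableAt hy),
    fderiv_apply₂ (hB.differentiableAt hy), fderiv_apply₂ (hB.differentiableAt hy)]

theorem contDiffOn_leviCivita : ContDiffOn ℝ ∞ (leviCivita B) U := by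
  have h1 := hB.contDiffOn_fderiv
  have h2 : ContDiffOn ℝ ∞ (fun y => (fderiv ℝ B y).flip) U :=
    (ContinuousLinearMap.flipₗᵢ ℝ (E d) (E d) (E d →L[ℝ] ℝ)).toContinuousLinearEquiv.contDiff
      |>.comp_contDiffOn h1
  refine ContDiffOn.clm_comp ?_ (ContDiffOn.const_smul _ ((h1.add h2).sub
    (contDiffOn_const.clm_comp h2)))
  exact (ContinuousLinearMap.contDiff _).comp_contDiffOn hB.contDiffOn_inverse

theorem differentiableAt_leviCivita (hy : y ∈ U) : DifferentiableAt ℝ (leviCivita B) y :=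
  differentiableAt_of_contDiffOn hB.contDiffOn_leviCivita hB.isOpen hy

theorem leviCivita_symm (hy : y ∈ U) (u v : E d) : leviCivita B y u v = leviCivita B y v u := by
  rw [leviCivita_apply, leviCivita_apply]
  congr 1
  ext w
  rw [koszulForm_apply, koszulForm_apply, hB.fderiv_symm hy w u v]
  ring

theorem fderiv_leviCivita_symm (hy : y ∈ U) (u v w : E d) :
    fderiv ℝ (leviCivita B) y u v w = fderiv ℝ (leviCivita B) y u w v := by
  have h := hB.differentiableAt_leviCivita hy
  rw [← fderiv_apply₂ h, ← fderiv_apply₂ h]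
  have : (fun z => leviCivita B z v w) =ᶠ[𝓝 y] fun z => leviCivita B z w v := by
    filter_upwards [hB.isOpen.mem_nhds hy] with z hz using hB.leviCivita_symm hz v w
  rw [this.fderiv_eq]

/-- The Levi-Civita connection is metric. -/
theorem fderiv_eq (hy : y ∈ U) (u v w : E d) : fderiv ℝ B y u v w =
    B y (leviCivita B y u v) w + B y v (leviCivita B y u w) := by
  rw [(hB.scalar y hy).symm v, leviCivita_apply, leviCivita_apply, hB.apply_inverse hy,
    hB.apply_inverse hy, koszulForm_apply, koszulForm_apply, hB.fderiv_symm hy u w v,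
    hB.fderiv_symm hy v u w, hB.fderiv_symm hy w u v]
  ring

end IsLocalMetric

/-- The curvature of the connection `A`. -/
noncomputable def curvatureMap (A : E d → E d →L[ℝ] E d →L[ℝ] E d) (y u v w : E d) : E d :=
  fderiv ℝ A y u v w + A y u (A y v w) - (fderiv ℝ A y v u w + A y v (A y u w))

theorem curvature_eq {A : E d → E d →L[ℝ] E d →L[ℝ] E d} (hA : DifferentiableAt ℝ A y)
    {A' : E d → E d → E d → E d} (h : ∀ᶠ z in 𝓝 y, ∀ u v, A' z u v = A z u v) (u v w : E d) :
    curvature A' y u v w = curvatureMap A y u v w := by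
  have h1 : ∀ v w, (fun z => A' z v w) =ᶠ[𝓝 y] fun z => A z v w := fun v w => by
    filter_upwards [h] with z hz using hz v w
  simp only [curvature, curvatureMap, (h1 _ _).fderiv_eq, h.self_of_nhds, fderiv_apply₂ hA]

namespace IsLocalMetric

variable (hB : IsLocalMetric B U)
include hB

theorem curvature_christoffel (hy : y ∈ U) (u v w : E d) :
    curvature (christoffel fun y u v => B y u v) y u v w =
      curvatureMap (leviCivita B) y u v w := by
  refine curvature_eq (hB.differentiableAt_leviCivita hy) ?_ u v w
  filter_upwards [hB.isOpen.mem_nhds hy] with z hz using hB.christoffel_eq hz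

/-- Differentiating metricity once more expresses the second derivative of `B(a, b)` through `Γ` and
its derivative. Symmetry of second derivatives makes the part skew in `u, v` vanish, and this part
is `B(R a, b) + B(a, R b)`. -/
theorem riemann_antisymm (hy : y ∈ U) (u v a b : E d) :
    B y (curvatureMap (leviCivita B) y u v b) a = -B y (curvatureMap (leviCivita B) y u v a) b := by
  have hB1 := hB.differentiableAt hy
  have hD := differentiableAt_of_contDiffOn hB.contDiffOn_fderiv hB.isOpen hy
  have hΓ := hB.differentiableAt_leviCivita hy
  have key : ∀ u v, fderiv ℝ (fderiv ℝ B) y u v a b =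
      fderiv ℝ B y u (leviCivita B y v a) b + B y (fderiv ℝ (leviCivita B) y u v a) b
      + (fderiv ℝ B y u a (leviCivita B y v b) + B y a (fderiv ℝ (leviCivita B) y u v b)) := by
    intro u v
    have hL := ((hD.hasFDerivAt.clm_apply (hasFDerivAt_const v y)).clm_apply
      (hasFDerivAt_const a y)).clm_apply (hasFDerivAt_const b y)
    have hΓa := (hΓ.hasFDerivAt.clm_apply (hasFDerivAt_const v y)).clm_apply (hasFDerivAt_const a y)
    have hΓb := (hΓ.hasFDerivAt.clm_apply (hasFDerivAt_const v y)).clm_apply (hasFDerivAt_const b y)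
    have hR := ((hB1.hasFDerivAt.clm_apply hΓa).clm_apply (hasFDerivAt_const b y)).add
      ((hB1.hasFDerivAt.clm_apply (hasFDerivAt_const a y)).clm_apply hΓb)
    have heq : (fun z => fderiv ℝ B z v a b) =ᶠ[𝓝 y] fun z =>
        B z (leviCivita B z v a) b + B z a (leviCivita B z v b) := by
      filter_upwards [hB.isOpen.mem_nhds hy] with z hz using hB.fderiv_eq hz v a b
    have := congrArg (fun l : E d →L[ℝ] ℝ => l u) (hL.unique (hR.congr_of_eventuallyEq heq))
    simp at this
    linarith
  have hsymm : fderiv ℝ (fderiv ℝ B) y u v = fderiv ℝ (fderiv ℝ B) y v u :=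
    ((hB.contDiffOn.contDiffAt (hB.isOpen.mem_nhds hy)).isSymmSndFDerivAt (by
      simp only [minSmoothness_of_isRCLikeNormedField]; exact WithTop.coe_le_coe.2 (le_top : (2 : ℕ∞) ≤ ⊤))) u v
  have h1 := key u v
  have h2 := key v u
  rw [hsymm, h2] at h1
  simp only [hB.fderiv_eq hy] at h1
  simp only [curvatureMap, map_add, map_sub, add_apply, sub_apply, (hB.scalar y hy).symm _ a]
  rw [(hB.scalar y hy).symm a] at h1
  simp only [(hB.scalar y hy).symm _ a] at h1 ⊢
  linarith

theorem isCurvatureTensor (hy : y ∈ U) :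
    IsCurvatureTensor fun u v a b => B y (curvatureMap (leviCivita B) y u v a) b where
  linear v a b := ⟨fun p q => by simp [curvatureMap]; ring, fun c p => by simp [curvatureMap]; ring⟩
  linear' u v b := ⟨fun p q => by simp [curvatureMap]; ring, fun c p => by simp [curvatureMap]; ring⟩
  antisymm u v a b := by simp [curvatureMap]
  antisymm' u v a b := hB.riemann_antisymm hy u v a b
  bianchi u v a b := by
    simp only [curvatureMap, map_add, map_sub, add_apply, sub_apply]
    rw [hB.fderiv_leviCivita_symm hy u v a, hB.fderiv_leviCivita_symm hy v a u,
      hB.fderiv_leviCivita_symm hy a u v, hB.leviCivita_symm hy v a, hB.leviCivita_symm hy u a,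
      hB.leviCivita_symm hy u v]
    ring

end IsLocalMetric

end LocalMetric

/-! ### Volume form and skew torsion in a three-dimensional coordinate domain -/

section LocalVolume

variable {B : E 3 → E 3 →L[ℝ] E 3 →L[ℝ] ℝ} {U : Set (E 3)} {y : E 3}
  {ρ φ : E 3 → ℝ} {η : E 3 [⋀^Fin 3]→ₗ[ℝ] ℝ}

/-- `ρ η` is, up to sign, the volume form of `B` on `U`. -/
structure IsLocalVolume (B : E 3 → E 3 →L[ℝ] E 3 →L[ℝ] ℝ) (U : Set (E 3)) (ρ : E 3 → ℝ)
    (η : E 3 [⋀^Fin 3]→ₗ[ℝ] ℝ) : Prop extends IsLocalMetric B U where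
  contDiffOn_density : ContDiffOn ℝ ∞ ρ U
  sq_eq_one : ∀ y ∈ U, (ρ y * η (frame 3 fun u v => B y u v)) ^ 2 = 1

/-- An alternating three-form as a curried continuous trilinear map. -/
noncomputable def curryThree (η : E 3 [⋀^Fin 3]→ₗ[ℝ] ℝ) : E 3 →L[ℝ] E 3 →L[ℝ] E 3 →L[ℝ] ℝ :=
  LinearMap.toContinuousLinearMap
    { toFun := fun a => LinearMap.toContinuousLinearMap
        { toFun := fun b => LinearMap.toContinuousLinearMap
            (IsLinearMap.mk' (fun c => η ![a, b, c]) (alternating_linear_right η a b))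
          map_add' := fun b b' => by
            ext c; exact (alternating_linear_mid η a c).map_add b b'
          map_smul' := fun r b => by
            ext c; exact (alternating_linear_mid η a c).map_smul r b }
      map_add' := fun a a' => by
        ext b c; exact (alternating_linear_left η b c).map_add a a'
      map_smul' := fun r a => by
        ext b c; exact (alternating_linear_left η b c).map_smul r a }

theorem curryThree_apply (a b c : E 3) : curryThree η a b c = η ![a, b, c] := rfl

/-- The cross product for the metric `B` and the volume form `ρ η`. -/
noncomputable def crossProduct (B : E 3 → E 3 →L[ℝ] E 3 →L[ℝ] ℝ) (ρ : E 3 → ℝ)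
    (η : E 3 [⋀^Fin 3]→ₗ[ℝ] ℝ) (y : E 3) : E 3 →L[ℝ] E 3 →L[ℝ] E 3 :=
  ρ y • (ContinuousLinearMap.compL ℝ (E 3) (E 3 →L[ℝ] ℝ) (E 3) (B y).inverse) ∘L curryThree η

theorem frame_comp_eq (e : Fin 3 → E 3) : e = ![e 0, e 1, e 2] := by
  ext i; fin_cases i <;> rfl

namespace IsLocalVolume

variable (hν : IsLocalVolume B U ρ η)
include hν

/-- The polarised form of the normalisation of `ρ η`. Its right-hand side involves the metric alone,
so it can be differentiated without a smooth frame. -/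
theorem gram (hy : y ∈ U) (a b c a' b' c' : E 3) :
    ρ y ^ 2 * (η ![a, b, c] * η ![a', b', c']) =
      B y a a' * (B y b b' * B y c c' - B y b c' * B y c b')
        - B y a b' * (B y b a' * B y c c' - B y b c' * B y c a')
        + B y a c' * (B y b a' * B y c b' - B y b b' * B y c a') := by
  have h := hν.scalar y hy
  have h1 := hν.sq_eq_one y hy
  rw [frame_comp_eq (frame 3 _)] at h1
  rw [alternating_gram (h.frame finrank_E) h finrank_E, ← mul_assoc, ← mul_pow, h1, one_mul]

theorem differentiableAt_density (hy : y ∈ U) : DifferentiableAt ℝ ρ y :=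
  differentiableAt_of_contDiffOn hν.contDiffOn_density hν.isOpen hy

/-- The volume form is parallel. -/
theorem fderiv_density (hy : y ∈ U) (u a b c : E 3) :
    fderiv ℝ ρ y u * η ![a, b, c] = ρ y * (η ![leviCivita B y u a, b, c]
      + η ![a, leviCivita B y u b, c] + η ![a, b, leviCivita B y u c]) := by
  set Γ := leviCivita B y u with hΓ
  have h1 := hν.sq_eq_one y hy
  -- Restriction to the line `y + t u` reduces the claim to one-variable derivatives at `t = 0`.
  have hline : HasDerivAt (fun t : ℝ => y + t • u) u 0 := by
    simpa using ((hasDerivAt_id (0 : ℝ)).smul_const u).const_add y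
  have hy0 : y + (0 : ℝ) • u = y := by simp
  have hρ : HasDerivAt (fun t : ℝ => ρ (y + t • u)) (fderiv ℝ ρ y u) 0 := by
    refine HasFDerivAt.comp_hasDerivAt (l := ρ) 0 ?_ hline
    rw [hy0]
    exact (hν.differentiableAt_density hy).hasFDerivAt
  have hBl : ∀ v w, HasDerivAt (fun t : ℝ => B (y + t • u) v w)
      (B y (Γ v) w + B y v (Γ w)) 0 := fun v w => by
    rw [hΓ, ← hν.fderiv_eq hy u v w, ← fderiv_apply₂ (hν.differentiableAt hy)]
    refine HasFDerivAt.comp_hasDerivAt (l := fun z => B z v w) 0 ?_ hline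
    rw [hy0]
    have h := (hν.differentiableAt hy).hasFDerivAt
    exact ((h.clm_apply (hasFDerivAt_const v y)).clm_apply
      (hasFDerivAt_const w y)).differentiableAt.hasFDerivAt
  have hmem : ∀ᶠ t in 𝓝 (0 : ℝ), y + t • u ∈ U := by
    refine hline.continuousAt.preimage_mem_nhds (hν.isOpen.mem_nhds ?_)
    rwa [hy0]
  have key : ∀ a b c a' b' c', 2 * (ρ y * fderiv ℝ ρ y u) * (η ![a, b, c] * η ![a', b', c']) =
      ρ y ^ 2 * ((η ![Γ a, b, c] + η ![a, Γ b, c] + η ![a, b, Γ c]) * η ![a', b', c']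
        + η ![a, b, c] * (η ![Γ a', b', c'] + η ![a', Γ b', c'] + η ![a', b', Γ c'])) := by
    intro a b c a' b' c'
    have hl := (hρ.pow 2).mul_const (η ![a, b, c] * η ![a', b', c'])
    have hr := (((hBl a a').mul (((hBl b b').mul (hBl c c')).sub ((hBl b c').mul (hBl c b')))).sub
      ((hBl a b').mul (((hBl b a').mul (hBl c c')).sub ((hBl b c').mul (hBl c a'))))).add
      ((hBl a c').mul (((hBl b a').mul (hBl c b')).sub ((hBl b b').mul (hBl c a'))))
    have := hl.unique (hr.congr_of_eventuallyEq (by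
      filter_upwards [hmem] with t ht using hν.gram ht a b c a' b' c'))
    simp only [hy0, Pi.mul_apply, Pi.sub_apply] at this
    -- By metricity the derivative of the Gram determinant is the sum of six Gram determinants with
    -- `Γ` applied in one slot; `gram` turns each back into a product of values of `η`.
    linear_combination this - hν.gram hy (Γ a) b c a' b' c' - hν.gram hy a (Γ b) c a' b' c'
      - hν.gram hy a b (Γ c) a' b' c' - hν.gram hy a b c (Γ a') b' c'
      - hν.gram hy a b c a' (Γ b') c' - hν.gram hy a b c a' b' (Γ c')
  rw [frame_comp_eq (frame 3 _)] at h1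
  generalize (frame 3 fun u v => B y u v) = e at h1
  have hne : ρ y * η ![e 0, e 1, e 2] ≠ 0 := fun h => by simp [h] at h1
  obtain ⟨hρ0, hη0⟩ := mul_ne_zero_iff.mp hne
  -- Both triples equal to the frame give the claim on the frame (`k3`). Pairing an arbitrary triple
  -- with the frame and inserting `k3` gives the general case.
  have k1 := key (e 0) (e 1) (e 2) (e 0) (e 1) (e 2)
  have k2 := key a b c (e 0) (e 1) (e 2)
  have k3 : fderiv ℝ ρ y u * η ![e 0, e 1, e 2] = ρ y * (η ![Γ (e 0), e 1, e 2]
      + η ![e 0, Γ (e 1), e 2] + η ![e 0, e 1, Γ (e 2)]) := by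
    refine mul_left_cancel₀ (mul_ne_zero two_ne_zero hne) ?_
    linear_combination k1
  refine mul_left_cancel₀ hne ?_
  linear_combination k2 - ρ y * η ![a, b, c] * k3

theorem apply_crossProduct (hy : y ∈ U) (u v w : E 3) :
    B y (crossProduct B ρ η y u v) w = ρ y * η ![u, v, w] := by
  have : crossProduct B ρ η y u v = ρ y • (B y).inverse (curryThree η u v) := rfl
  rw [this, map_smul, smul_apply, hν.apply_inverse hy, curryThree_apply, smul_eq_mul]

theorem contDiffOn_crossProduct : ContDiffOn ℝ ∞ (crossProduct B ρ η) U := by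
  refine hν.contDiffOn_density.smul (ContDiffOn.clm_comp ?_ contDiffOn_const)
  exact (ContinuousLinearMap.contDiff _).comp_contDiffOn hν.contDiffOn_inverse

theorem differentiableAt_crossProduct (hy : y ∈ U) :
    DifferentiableAt ℝ (crossProduct B ρ η) y :=
  differentiableAt_of_contDiffOn hν.contDiffOn_crossProduct hν.isOpen hy

/-- The cross product is parallel. -/
theorem fderiv_crossProduct (hy : y ∈ U) (u v w b : E 3) :
    B y (fderiv ℝ (crossProduct B ρ η) y u v w) b =
      ρ y * (η ![leviCivita B y u v, w, b] + η ![v, leviCivita B y u w, b])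
        - B y (leviCivita B y u (crossProduct B ρ η y v w)) b := by
  have hC := ((hν.differentiableAt_crossProduct hy).hasFDerivAt.clm_apply
    (hasFDerivAt_const v y)).clm_apply (hasFDerivAt_const w y)
  have hl := ((hν.differentiableAt hy).hasFDerivAt.clm_apply hC).clm_apply (hasFDerivAt_const b y)
  have hr := (hν.differentiableAt_density hy).hasFDerivAt.mul_const (η ![v, w, b])
  have heq : (fun z => B z (crossProduct B ρ η z v w) b) =ᶠ[𝓝 y] fun z => ρ z * η ![v, w, b] := by
    filter_upwards [hν.isOpen.mem_nhds hy] with z hz using hν.apply_crossProduct hz v w b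
  have := congrArg (fun l : E 3 →L[ℝ] ℝ => l u) (hl.unique (hr.congr_of_eventuallyEq heq))
  simp at this
  rw [mul_comm (η _), hν.fderiv_density hy, hν.fderiv_eq hy, hν.apply_crossProduct hy] at this
  linear_combination this

/-- The connection with skew torsion `-φ ρ η`. -/
theorem torsionConnection_eq (hy : y ∈ U) {H : E 3 → (Fin 3 → E 3) → ℝ}
    (hH : ∀ z ∈ U, ∀ v, H z v = φ z * (ρ z * η v)) (u v : E 3) :
    torsionConnection (fun y u v => B y u v) H y u v =
      (leviCivita B y - ((1 / 2 : ℝ) • φ y) • crossProduct B ρ η y) u v := by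
  have : sharp 3 (fun u v => B y u v) (fun w => H y ![u, v, w]) =
      φ y • crossProduct B ρ η y u v := by
    refine (hν.scalar y hy).ext fun w => ?_
    have hs := sharp_spec (hν.scalar y hy) finrank_E (α := fun w => H y ![u, v, w])
      (by simp only [hH y hy]
          exact ⟨fun a b => by rw [(alternating_linear_right η u v).map_add]; ring,
            fun c a => by rw [(alternating_linear_right η u v).map_smul]; simp; ring⟩) w
    rw [hs, hH y hy, map_smul, smul_apply, hν.apply_crossProduct hy, smul_eq_mul]
  rw [torsionConnection, hν.christoffel_eq hy, this]
  simp [smul_smul]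

/-- The curvature of the connection with skew torsion `-φ ρ η`. -/
theorem curvature_torsionConnection (hy : y ∈ U) (hφ : ContDiffOn ℝ ∞ φ U)
    {H : E 3 → (Fin 3 → E 3) → ℝ} (hH : ∀ z ∈ U, ∀ v, H z v = φ z * (ρ z * η v))
    (u v w b : E 3) :
    B y (curvature (torsionConnection (fun y u v => B y u v) H) y u v w) b =
      skewTorsionCurvature (fun u v => B y u v)
        (fun u v a b => B y (curvatureMap (leviCivita B) y u v a) b) (ρ y • η) (φ y)
        (fderiv ℝ φ y) u v w b := by
  have hφ' := differentiableAt_of_contDiffOn hφ hν.isOpen hy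
  have hA : HasFDerivAt (fun z => leviCivita B z - ((1 / 2 : ℝ) • φ z) • crossProduct B ρ η z)
      _ y := (hν.differentiableAt_leviCivita hy).hasFDerivAt.sub
    ((hφ'.hasFDerivAt.const_smul (1 / 2 : ℝ)).smul
      (hν.differentiableAt_crossProduct hy).hasFDerivAt)
  rw [curvature_eq hA.differentiableAt (by
    filter_upwards [hν.isOpen.mem_nhds hy] with z hz using hν.torsionConnection_eq hz hH)]
  have h := hν.scalar y hy
  have he := h.frame (finrank_E (d := 3))
  have hσ := hν.sq_eq_one y hy
  rw [frame_comp_eq (frame 3 _)] at hσ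
  have hc := cross_cross he h finrank_E (ρ y • η) (by simpa using hσ)
    (C := fun u v => crossProduct B ρ η y u v) (fun u v w => hν.apply_crossProduct hy u v w)
  have hs := hν.leviCivita_symm hy u v
  simp only [curvatureMap, hA.fderiv, skewTorsionCurvature]
  simp
  simp only [hν.fderiv_crossProduct hy, hν.apply_crossProduct hy] at hc ⊢
  -- After the cross product has been treated as parallel, the surviving first-order terms are
  -- `η(Γ_u v, w, b)` and `η(Γ_v u, w, b)` with opposite signs; they cancel since `Γ` is symmetric.
  rw [hs]
  linear_combination φ y ^ 2 / 4 * (hc u v w b - hc v u w b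
    + B y w b * (h.symm v u))

end IsLocalVolume

end LocalVolume

/-! ### Differential operators on three-forms in a three-dimensional coordinate domain -/

section LocalOperators

variable {B : E 3 → E 3 →L[ℝ] E 3 →L[ℝ] ℝ} {U : Set (E 3)} {y : E 3}
  {ρ φ : E 3 → ℝ} {η : E 3 [⋀^Fin 3]→ₗ[ℝ] ℝ}

namespace IsLocalVolume

variable (hν : IsLocalVolume B U ρ η) (hφ : ContDiffOn ℝ ∞ φ U)
  {H : E 3 → (Fin 3 → E 3) → ℝ} (hH : ∀ z ∈ U, ∀ v, H z v = φ z * (ρ z * η v))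
include hν hφ hH

/-- A three-form is closed in dimension three. -/
theorem extDer_eq_zero (hy : y ∈ U) (v : Fin 4 → E 3) : extDer H y v = 0 := by
  have hd : DifferentiableAt ℝ (fun z => φ z * ρ z) y :=
    (differentiableAt_of_contDiffOn hφ hν.isOpen hy).mul (hν.differentiableAt_density hy)
  have h1 : ∀ w u, fderiv ℝ (fun z => H z w) y u = fderiv ℝ (fun z => φ z * ρ z) y u * η w := by
    intro w u
    have heq : (fun z => H z w) =ᶠ[𝓝 y] fun z => φ z * ρ z * η w := by
      filter_upwards [hν.isOpen.mem_nhds hy] with z hz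
      rw [hH z hz, mul_assoc]
    rw [heq.fderiv_eq, (hd.hasFDerivAt.mul_const (η w)).fderiv]
    simp [mul_comm]
  have h := hν.scalar y hy
  -- With `η` constant, the exterior derivative is `d(φρ) ∧ η`, a four-form in dimension three.
  have hw := covector_wedge_alternating (h.frame finrank_E) h finrank_E η
    (α := fderiv ℝ (fun z => φ z * ρ z) y) ⟨map_add _, map_smul _⟩ (v 0) (v 1) (v 2) (v 3)
  have r0 : (0 : Fin 4).removeNth v = ![v 1, v 2, v 3] := by ext i; fin_cases i <;> rfl
  have r1 : (1 : Fin 4).removeNth v = ![v 0, v 2, v 3] := by ext i; fin_cases i <;> rfl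
  have r2 : (2 : Fin 4).removeNth v = ![v 0, v 1, v 3] := by ext i; fin_cases i <;> rfl
  have r3 : (3 : Fin 4).removeNth v = ![v 0, v 1, v 2] := by ext i; fin_cases i <;> rfl
  rw [← hw, extDer]
  refine (Fin.sum_univ_four _).trans ?_
  simp only [h1, r0, r1, r2, r3]
  norm_num
  ring

/-- The volume form is parallel, so only `φ` is differentiated. -/
theorem covDer_eq (hy : y ∈ U) (u a b c : E 3) :
    covDer (fun y u v => B y u v) H y u ![a, b, c] =
      fderiv ℝ φ y u * (ρ y * η ![a, b, c]) := by
  have hφ' := differentiableAt_of_contDiffOn hφ hν.isOpen hy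
  have heq : (fun z => H z ![a, b, c]) =ᶠ[𝓝 y] fun z => φ z * (ρ z * η ![a, b, c]) := by
    filter_upwards [hν.isOpen.mem_nhds hy] with z hz using hH z hz _
  have hd : HasFDerivAt (fun z => φ z * (ρ z * η ![a, b, c])) _ y :=
    hφ'.hasFDerivAt.mul ((hν.differentiableAt_density hy).hasFDerivAt.mul_const (η ![a, b, c]))
  have r0 : ∀ x, Function.update ![a, b, c] 0 x = ![x, b, c] := fun x => by
    ext i; fin_cases i <;> rfl
  have r1 : ∀ x, Function.update ![a, b, c] 1 x = ![a, x, c] := fun x => by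
    ext i; fin_cases i <;> rfl
  have r2 : ∀ x, Function.update ![a, b, c] 2 x = ![a, b, x] := fun x => by
    ext i; fin_cases i <;> rfl
  have hp := hν.fderiv_density hy u a b c
  rw [covDer, heq.fderiv_eq, hd.fderiv]
  simp only [Fin.sum_univ_three, r0, r1, r2, hν.christoffel_eq hy, hH y hy]
  simp
  linear_combination φ y * hp

/-- The contraction over the frame reassembles the gradient of `φ`: this is `δ(φν) = -grad φ ⌟ ν`,
with no frame left to differentiate. -/
theorem codiff_eq (hy : y ∈ U) (v : Fin 2 → E 3) :
    codiff (fun y u v => B y u v) H y v =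
      -(ρ y * η ![(B y).inverse (fderiv ℝ φ y), v 0, v 1]) := by
  have hv : ∀ x, (Fin.cons x v : Fin 3 → E 3) = ![x, v 0, v 1] := fun x => by
    ext i; fin_cases i <;> rfl
  rw [codiff, ← hν.sharp_eq hy, sharp,
    IsLinearMap.sum_apply (α := fun u => η ![u, v 0, v 1]) (alternating_linear_left η _ _),
    Finset.mul_sum]
  simp only [hv, hν.covDer_eq hφ hH hy, smul_eq_mul]
  congr 1
  exact Finset.sum_congr rfl fun i _ => by ring

/-- `dδ(φν) = (Δφ) ν`. -/
theorem extDer_codiff (hy : y ∈ U) (v : Fin 3 → E 3) :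
    extDer (codiff (fun y u v => B y u v) H) y v =
      codiff (k := 0) (fun y u v => B y u v) (fun y v => fderiv ℝ φ y (v 0)) y ![]
        * (ρ y * η v) := by
  set Γ := leviCivita B y with hΓ
  set X : E 3 → E 3 := fun z => (B z).inverse (fderiv ℝ φ z) with hX
  have hdφ := hφ.fderiv_of_isOpen hν.isOpen (m := ∞) (by simp)
  have hdφ' := differentiableAt_of_contDiffOn hdφ hν.isOpen hy
  have hXd : DifferentiableAt ℝ X y :=
    differentiableAt_of_contDiffOn (hν.contDiffOn_inverse.clm_apply hdφ) hν.isOpen hy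
  have hcod : ∀ w u, fderiv ℝ (fun z => codiff (fun y u v => B y u v) H z w) y u =
      -(fderiv ℝ ρ y u * η ![X y, w 0, w 1] + ρ y * η ![fderiv ℝ X y u, w 0, w 1]) := by
    intro w u
    have heq : (fun z => codiff (fun y u v => B y u v) H z w) =ᶠ[𝓝 y]
        fun z => -(ρ z * ((curryThree η).flip (w 0)).flip (w 1) (X z)) := by
      filter_upwards [hν.isOpen.mem_nhds hy] with z hz using hν.codiff_eq hφ hH hz w
    have hd := ((hν.differentiableAt_density hy).hasFDerivAt.mul
      ((((curryThree η).flip (w 0)).flip (w 1)).hasFDerivAt.comp y hXd.hasFDerivAt)).neg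
    rw [heq.fderiv_eq]
    refine (congrArg (fun l : E 3 →L[ℝ] ℝ => l u) hd.fderiv).trans ?_
    simp [curryThree_apply]
    ring
  have h := hν.scalar y hy
  have he := h.frame (finrank_E (d := 3))
  -- `L` is `u ↦ ∇_u grad φ`, the Hessian as an endomorphism, with trace `-Δφ`. Applied as a
  -- derivation to `η` it yields `tr(L) η`, which is `d(grad φ ⌟ ν)` up to the density.
  set L : E 3 → E 3 := fun u => fderiv ℝ X y u + Γ u (X y) with hL
  have hLlin : IsLinearMap ℝ L := ⟨fun a b => by simp [hL]; abel, fun c a => by simp [hL]⟩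
  have htr := alternating_derivation he h finrank_E η hLlin (v 0) (v 1) (v 2)
  have hXL : ∀ u w, B y (L u) w = fderiv ℝ (fderiv ℝ φ) y u w - fderiv ℝ φ y (Γ u w) := by
    intro u w
    have hl := ((hν.differentiableAt hy).hasFDerivAt.clm_apply hXd.hasFDerivAt).clm_apply
      (hasFDerivAt_const w y)
    have hr := hdφ'.hasFDerivAt.clm_apply (hasFDerivAt_const w y)
    have heq : (fun z => B z (X z) w) =ᶠ[𝓝 y] fun z => fderiv ℝ φ z w := by
      filter_upwards [hν.isOpen.mem_nhds hy] with z hz using hν.apply_inverse hz _ w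
    have := congrArg (fun l : E 3 →L[ℝ] ℝ => l u) (hl.unique (hr.congr_of_eventuallyEq heq))
    simp at this
    rw [hν.fderiv_eq hy, ← hΓ] at this
    have h2 : B y (X y) (Γ u w) = fderiv ℝ φ y (Γ u w) := hν.apply_inverse hy _ _
    rw [h2] at this
    simp only [hL, map_add, add_apply]
    linear_combination this
  have hlap : codiff (k := 0) (fun y u v => B y u v) (fun y v => fderiv ℝ φ y (v 0)) y ![] =
      -∑ i, B y (L (frame 3 (fun u v => B y u v) i)) (frame 3 (fun u v => B y u v) i) := by
    rw [codiff]
    congr 1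
    refine Finset.sum_congr rfl fun i _ => ?_
    rw [hXL, covDer]
    have hd := hdφ'.hasFDerivAt.clm_apply (hasFDerivAt_const (frame 3 (fun u v => B y u v) i) y)
    simp only [Fin.cons_zero, hν.christoffel_eq hy, hd.fderiv]
    simp [hΓ]
  rw [hlap]
  have r0 : (0 : Fin 3).removeNth v = ![v 1, v 2] := by ext i; fin_cases i <;> rfl
  have r1 : (1 : Fin 3).removeNth v = ![v 0, v 2] := by ext i; fin_cases i <;> rfl
  have r2 : (2 : Fin 3).removeNth v = ![v 0, v 1] := by ext i; fin_cases i <;> rfl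
  have hv : η v = η ![v 0, v 1, v 2] := by rw [← frame_comp_eq]
  have hρ := hν.fderiv_density hy
  rw [← hΓ] at hρ
  have hcyc : ∀ a b x, η ![x, a, b] = η ![a, b, x] := fun a b x => by
    rw [alternating_swap_left, alternating_swap_right, neg_neg]
  simp only [show ∀ u, L u = fderiv ℝ X y u + Γ u (X y) from fun _ => rfl,
    (alternating_linear_left η _ _).map_add, (alternating_linear_mid η _ _).map_add,
    (alternating_linear_right η _ _).map_add] at htr
  rw [hv, neg_mul, mul_left_comm]
  refine Eq.trans ?_ (congrArg (fun r => -(ρ y * r)) htr)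
  rw [extDer]
  refine (Fin.sum_univ_three _).trans ?_
  simp only [hcod, r0, r1, r2, Matrix.cons_val_zero, Matrix.cons_val_one, hρ]
  -- The terms with `Γ(vᵢ, vⱼ)` cancel in pairs by symmetry of `Γ`; those with `L(vᵢ)` form the
  -- derivation in `htr`.
  rw [← hcyc _ _ (fderiv ℝ X y (v 2)), ← hcyc _ _ (Γ (v 2) (X y)),
    alternating_swap_left η _ (v 0) (v 2), alternating_swap_left η _ (v 0) (v 2),
    alternating_swap_right η _ (v 1) (Γ (v 2) (v 0)),
    show Γ (v 1) (v 0) = Γ (v 0) (v 1) from hν.leviCivita_symm hy _ _,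
    show Γ (v 2) (v 0) = Γ (v 0) (v 2) from hν.leviCivita_symm hy _ _,
    show Γ (v 2) (v 1) = Γ (v 1) (v 2) from hν.leviCivita_symm hy _ _]
  norm_num
  ring

end IsLocalVolume

end LocalOperators

/-! ### Tensors in charts -/

section Charts

variable {d : ℕ} {M : Type*} [TopologicalSpace M] [ChartedSpace (E d) M] [IsManifold (𝓡 d) ∞ M]

instance (x : M) : FiniteDimensional ℝ (TangentSpace (𝓡 d) x) :=
  inferInstanceAs (FiniteDimensional ℝ (E d))

omit [IsManifold (𝓡 d) ∞ M] in
theorem finrank_tangentSpace (x : M) : Module.finrank ℝ (TangentSpace (𝓡 d) x) = d :=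
  finrank_E

theorem isManifold_one : IsManifold (𝓡 d) 1 M := IsManifold.of_le (n := ∞) (by simp)

/-- The tangent space at `x` is the model space read through the preferred chart at `x`, so the
differential of that chart at `x` is the identity. -/
theorem toChart_eq (x : M) (v : TangentSpace (𝓡 d) x) : toChart x v = v := by
  have := isManifold_one (d := d) (M := M)
  have h := mfderiv_extChartAt_self (I := 𝓡 d) (x := x)
  exact congrArg (fun l : E d →L[ℝ] E d => l v) h

omit [IsManifold (𝓡 d) ∞ M] in
theorem mfderivWithin_extChartAt_symm_eq (x : M) {y y' : E d} (h : y' = y) (v : E d) :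
    (mfderivWithin 𝓘(ℝ, E d) (𝓡 d) (extChartAt (𝓡 d) x).symm (Set.range (𝓡 d)) y' v : E d) =
      fromChart x y v := by
  subst h
  have hr : Set.range (𝓡 d) = Set.univ := (𝓡 d).range_eq_univ
  rw [hr, mfderivWithin_univ]
  rfl

/-- Links coordinate vector fields to the bundle trivialization, in which smoothness of metrics and
local constancy of orientations are expressed. -/
theorem fromChart_eq (x : M) {y : E d} (hy : y ∈ (chartAt (E d) x).target) (v : E d) :
    fromChart x y v = (trivializationAt (E d) (TangentSpace (𝓡 d)) x).symm
      ((chartAt (E d) x).symm y) v := by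
  have := isManifold_one (d := d) (M := M)
  have hx := (chartAt (E d) x).map_target hy
  have h := TangentBundle.symmL_trivializationAt (I := 𝓡 d) hx
  have h2 : extChartAt (𝓡 d) x ((chartAt (E d) x).symm y) = y := (chartAt (E d) x).right_inv hy
  have h3 := congrArg (fun l : E d →L[ℝ] E d => l v) h
  have hb : (chartAt (E d) x).symm y ∈
      (trivializationAt (E d) (TangentSpace (𝓡 d)) x).baseSet := by simpa using hx
  rw [← Bundle.Trivialization.symmL_apply (R := ℝ) _ hb]
  exact (mfderivWithin_extChartAt_symm_eq x h2 v).symm.trans h3.symm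

theorem fromChart_self (x : M) (v : E d) : (fromChart x (chartAt (E d) x x) v : E d) = v := by
  have := isManifold_one (d := d) (M := M)
  have h := mfderivWithin_range_extChartAt_symm (I := 𝓡 d) (x := x)
  have h3 := congrArg (fun l : E d →L[ℝ] E d => l v) h
  exact (mfderivWithin_extChartAt_symm_eq x rfl v).symm.trans h3

theorem Metric.isScalarProduct (g : Metric d M) (x : M) : IsScalarProduct (g.at x) where
  linear v := ⟨fun a b => by simp [Metric.at], fun c a => by simp [Metric.at]⟩
  symm := g.symm x
  pos := g.pos x

theorem fromChart_injective (x : M) {y : E d} (hy : y ∈ (chartAt (E d) x).target) :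
    Function.Injective (fromChart x y) := by
  intro u v huv
  rw [fromChart_eq x hy, fromChart_eq x hy] at huv
  have hx : (chartAt (E d) x).symm y ∈
      (trivializationAt (E d) (TangentSpace (𝓡 d)) x).baseSet := by
    simpa using (chartAt (E d) x).map_target hy
  have h := congrArg (fun w => (trivializationAt (E d) (TangentSpace (𝓡 d)) x
    ⟨(chartAt (E d) x).symm y, w⟩).2) huv
  simpa [Bundle.Trivialization.apply_mk_symm _ hx] using h

/-- The chart expression of a metric, as a bundled bilinear form. -/
noncomputable def Metric.chartForm (g : Metric d M) (x : M) (y : E d) : E d →L[ℝ] E d →L[ℝ] ℝ :=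
  LinearMap.toContinuousLinearMap
    { toFun := fun u => LinearMap.toContinuousLinearMap
        { toFun := fun v => g.inChart x y u v
          map_add' := fun v w => by simp [Metric.inChart, Metric.at]
          map_smul' := fun c v => by simp [Metric.inChart, Metric.at] }
      map_add' := fun u v => by ext w; simp [Metric.inChart, Metric.at]
      map_smul' := fun c v => by ext w; simp [Metric.inChart, Metric.at] }

theorem contMDiffAt_fromChart (x : M) {y : E d} (hy : y ∈ (chartAt (E d) x).target) (u : E d) :
    ContMDiffAt 𝓘(ℝ, E d) ((𝓡 d).prod 𝓘(ℝ, E d)) ∞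
      (fun z => Bundle.TotalSpace.mk' (E d) (E := TangentSpace (𝓡 d))
        ((chartAt (E d) x).symm z) (fromChart x z u)) y := by
  have hx := (chartAt (E d) x).map_target hy
  have hs : ContMDiffAt 𝓘(ℝ, E d) (𝓡 d) ∞ (chartAt (E d) x).symm y :=
    (contMDiffOn_chart_symm (I := 𝓡 d) (x := x)).contMDiffAt
      ((chartAt (E d) x).open_target.mem_nhds hy)
  rw [(trivializationAt (E d) (TangentSpace (𝓡 d)) x).contMDiffAt_iff (by simpa using hx)]
  refine ⟨hs, (contMDiffAt_const (c := u)).congr_of_eventuallyEq ?_⟩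
  filter_upwards [(chartAt (E d) x).open_target.mem_nhds hy] with z hz
  have hz' : (chartAt (E d) x).symm z ∈
      (trivializationAt (E d) (TangentSpace (𝓡 d)) x).baseSet := by
    simpa using (chartAt (E d) x).map_target hz
  rw [fromChart_eq x hz]
  exact congrArg Prod.snd (Bundle.Trivialization.apply_mk_symm _ hz' u)

theorem Metric.contDiffOn_inChart (g : Metric d M) (x : M) (u v : E d) :
    ContDiffOn ℝ ∞ (fun y => g.inChart x y u v) (chartAt (E d) x).target := by
  intro y hy
  have hs : ContMDiffAt 𝓘(ℝ, E d) (𝓡 d) ∞ (chartAt (E d) x).symm y :=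
    (contMDiffOn_chart_symm (I := 𝓡 d) (x := x)).contMDiffAt
      ((chartAt (E d) x).open_target.mem_nhds hy)
  have h : ContMDiffAt 𝓘(ℝ, E d) ((𝓡 d).prod 𝓘(ℝ)) ∞
      (fun z => Bundle.TotalSpace.mk' ℝ (E := Bundle.Trivial M ℝ) ((chartAt (E d) x).symm z)
        (g.inner ((chartAt (E d) x).symm z) (fromChart x z u) (fromChart x z v))) y := by
    apply ContMDiffAt.clm_bundle_apply₂ (F₁ := E d) (F₂ := E d)
    · exact ContMDiffAt.comp y g.contMDiff.contMDiffAt hs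
    · exact contMDiffAt_fromChart x hy u
    · exact contMDiffAt_fromChart x hy v
  rw [Bundle.contMDiffAt_totalSpace] at h
  exact h.2.contDiffAt.contDiffWithinAt

theorem Metric.isLocalMetric (g : Metric d M) (x : M) :
    IsLocalMetric (g.chartForm x) (chartAt (E d) x).target where
  isOpen := (chartAt (E d) x).open_target
  contDiffOn := by
    rw [contDiffOn_clm_apply]
    intro u
    rw [contDiffOn_clm_apply]
    exact fun v => g.contDiffOn_inChart x u v
  scalar y hy :=
    { linear := fun v => ⟨fun a b => by simp, fun c a => by simp⟩
      symm := fun u v => g.symm _ _ _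
      pos := fun v hv => g.pos _ _ fun h => hv (fromChart_injective x hy (by simpa using h)) }

theorem Metric.inChart_self (g : Metric d M) (x : M) (u v : TangentSpace (𝓡 d) x) :
    g.inChart x (chartAt (E d) x x) u v = g.at x u v := by
  -- The base point of the chart expression equals `x` only propositionally; generalising the point
  -- and the identification of tangent spaces allows both to be substituted.
  have key : ∀ (p : M) (hp : p = x) (L : E d → E d), L = id →
      g.at p (L u) (L v) = g.at x u v := by
    rintro p rfl L rfl
    rfl
  exact key _ ((chartAt (E d) x).left_inv (mem_chart_source _ x)) _ (funext (fromChart_self x))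

theorem FormField.inChart_self {k : ℕ} (η : FormField d M k) (x : M)
    (v : Fin k → TangentSpace (𝓡 d) x) : η.inChart x (chartAt (E d) x x) v = η x v := by
  have key : ∀ (p : M) (hp : p = x) (L : E d → E d), L = id →
      η p (fun i => L (v i)) = η x v := by
    rintro p rfl L rfl
    rfl
  exact key _ ((chartAt (E d) x).left_inv (mem_chart_source _ x)) _ (funext (fromChart_self x))

end Charts

/-! ### The volume form in a chart -/

section ThreeForms

variable {V : Type*} [AddCommGroup V] [Module ℝ V] [FiniteDimensional ℝ V]
  {B : V → V → ℝ} {e : Fin 3 → V}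

theorem alternating_frame_ne_zero (he : IsOrthonormalFrame B e) (hB : IsScalarProduct B)
    (h3 : Module.finrank ℝ V = 3) {η : V [⋀^Fin 3]→ₗ[ℝ] ℝ} (hη : η ≠ 0) : η e ≠ 0 := by
  intro h
  refine hη (AlternatingMap.ext fun v => ?_)
  have hv : ∀ v : Fin 3 → V, v = ![v 0, v 1, v 2] := fun v => by ext i; fin_cases i <;> rfl
  rw [hv e] at h
  rw [hv v, alternating_eq_det he hB h3, h, zero_mul]
  rfl

/-- The Gram determinant of three vectors. -/
noncomputable def gramDet (B : V → V → ℝ) (v : Fin 3 → V) : ℝ :=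
  B (v 0) (v 0) * (B (v 1) (v 1) * B (v 2) (v 2) - B (v 1) (v 2) * B (v 2) (v 1))
    - B (v 0) (v 1) * (B (v 1) (v 0) * B (v 2) (v 2) - B (v 1) (v 2) * B (v 2) (v 0))
    + B (v 0) (v 2) * (B (v 1) (v 0) * B (v 2) (v 1) - B (v 1) (v 1) * B (v 2) (v 0))

theorem alternating_sq (he : IsOrthonormalFrame B e) (hB : IsScalarProduct B)
    (h3 : Module.finrank ℝ V = 3) (η : V [⋀^Fin 3]→ₗ[ℝ] ℝ) (v : Fin 3 → V) :
    η v ^ 2 = η e ^ 2 * gramDet B v := by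
  have hv : ∀ v : Fin 3 → V, η v = η ![v 0, v 1, v 2] := fun v => by
    congr 1; ext i; fin_cases i <;> rfl
  rw [hv v, hv e, sq, alternating_gram he hB h3, gramDet]

omit [FiniteDimensional ℝ V] [Module ℝ V] [AddCommGroup V] in
theorem gramDet_frame (he : IsOrthonormalFrame B e) : gramDet B e = 1 := by
  obtain ⟨h00, h01, h02, h10, h11, h12, h20, h21, h22⟩ := he.values
  simp only [gramDet, h00, h01, h02, h10, h11, h12, h20, h21, h22]
  norm_num

theorem alternating_sq_frame (he : IsOrthonormalFrame B e) (hB : IsScalarProduct B)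
    (h3 : Module.finrank ℝ V = 3) (η : V [⋀^Fin 3]→ₗ[ℝ] ℝ) {e' : Fin 3 → V}
    (he' : IsOrthonormalFrame B e') : η e' ^ 2 = η e ^ 2 := by
  rw [alternating_sq he hB h3, gramDet_frame he', mul_one]

end ThreeForms

section VolumeForm

variable {M : Type*} [TopologicalSpace M] [ChartedSpace (E 3) M] [IsManifold (𝓡 3) ∞ M]

/-- Only the square is determined, since the chosen frame need not be positively oriented. -/
theorem Metric.volumeForm_frame_sq (g : Metric 3 M) (o : ManifoldOrientation 3 M) (x : M) :
    g.volumeForm o x (frame 3 (g.at x)) ^ 2 = 1 := by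
  have h := g.isScalarProduct x
  have h0 := alternating_frame_ne_zero (h.frame (finrank_tangentSpace x)) h
    (finrank_tangentSpace x) (o.orient x).someVector_ne_zero
  rw [Metric.volumeForm, AlternatingMap.smul_apply, smul_eq_mul, mul_pow, inv_pow, sq_abs,
    inv_mul_cancel₀ (pow_ne_zero 2 h0)]

/-- Near `x` the orientation is that of a fixed three-form on the coordinate space. -/
theorem ManifoldOrientation.exists_chart (o : ManifoldOrientation 3 M) (x : M) :
    ∃ η : E 3 [⋀^Fin 3]→ₗ[ℝ] ℝ, η ≠ 0 ∧ ∃ U : Set (E 3), IsOpen U ∧ chartAt (E 3) x x ∈ U ∧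
      U ⊆ (chartAt (E 3) x).target ∧ ∀ y ∈ U, ∃ s : ℝ, 0 < s ∧ ∀ v : Fin 3 → E 3,
        (o.orient ((chartAt (E 3) x).symm y)).someVector (fun i => fromChart x y (v i)) =
          s * η v := by
  obtain ⟨r, hr⟩ := o.locallyConstant x
  refine ⟨r.someVector, r.someVector_ne_zero, ?_⟩
  have hc : Filter.Tendsto (chartAt (E 3) x).symm (𝓝 (chartAt (E 3) x x)) (𝓝 x) := by
    have := (chartAt (E 3) x).continuousAt_symm (mem_chart_target (E 3) x)
    rwa [ContinuousAt, (chartAt (E 3) x).left_inv (mem_chart_source (E 3) x)] at this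
  obtain ⟨U, hU, hUo, hxU⟩ := mem_nhds_iff.mp (Filter.inter_mem (hc.eventually hr)
    ((chartAt (E 3) x).open_target.mem_nhds (mem_chart_target (E 3) x)))
  refine ⟨U, hUo, hxU, fun y hy => (hU hy).2, fun y hy => ?_⟩
  obtain ⟨hb, hor⟩ := (hU hy).1
  have hyt := (hU hy).2
  set p := (chartAt (E 3) x).symm y
  set L := ((trivializationAt (E 3) (TangentSpace (𝓡 3)) x).continuousLinearEquivAt ℝ p
    hb).toLinearEquiv
  have h1 : (o.orient p) = rayOfNeZero ℝ _ (o.orient p).someVector_ne_zero :=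
    (Module.Ray.someVector_ray _).symm
  rw [h1, Orientation.map_apply, ← Module.Ray.someVector_ray r, ray_eq_iff] at hor
  -- Orientations are rays of alternating forms, so equal orientations differ by a positive factor.
  -- Its dependence on `y` is not controlled here.
  obtain ⟨s, hs, hsr⟩ := hor.symm.exists_pos_left r.someVector_ne_zero (by
    rw [Ne, AlternatingMap.compLinearEquiv_eq_zero_iff]
    exact (o.orient p).someVector_ne_zero)
  refine ⟨s, hs, fun v => ?_⟩
  have := congrArg (fun l : E 3 [⋀^Fin 3]→ₗ[ℝ] ℝ => l v) hsr
  simp only [AlternatingMap.smul_apply, smul_eq_mul, AlternatingMap.compLinearMap_apply] at this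
  rw [this]
  congr 1
  ext i
  rw [fromChart_eq x hyt, ← Bundle.Trivialization.symmL_apply (R := ℝ) _ hb]
  exact (congrFun (Bundle.Trivialization.symm_continuousLinearEquivAt_eq (R := ℝ) _ hb)
    (v i)).symm

/-- The volume form in the chart at `x`. -/
theorem Metric.exists_localVolume (g : Metric 3 M) (o : ManifoldOrientation 3 M) (x : M) :
    ∃ (U : Set (E 3)) (ρ : E 3 → ℝ) (η : E 3 [⋀^Fin 3]→ₗ[ℝ] ℝ), chartAt (E 3) x x ∈ U ∧
      U ⊆ (chartAt (E 3) x).target ∧ IsLocalVolume (g.chartForm x) U ρ η ∧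
      ∀ y ∈ U, ∀ v, FormField.inChart (g.volumeForm o) x y v = ρ y * η v := by
  obtain ⟨η, hη, U, hUo, hxU, hUt, hU⟩ := o.exists_chart x
  have hG := g.isLocalMetric x
  have h3 := finrank_E (d := 3)
  -- The frame at the base point, kept fixed as `y` varies, so that its Gram determinant `D` is
  -- smooth in `y`.
  set b := frame 3 fun u v => g.chartForm x (chartAt (E 3) x x) u v
  have hηb : η b ≠ 0 := alternating_frame_ne_zero ((hG.scalar _ (hUt hxU)).frame h3)
    (hG.scalar _ (hUt hxU)) h3 hη
  set D : E 3 → ℝ := fun y => gramDet (fun u v => g.chartForm x y u v) b with hD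
  have key : ∀ y ∈ U, ∃ τ : ℝ, 0 < τ ∧
      (τ * η (frame 3 fun u v => g.chartForm x y u v)) ^ 2 = 1 ∧
      ∀ v, FormField.inChart (g.volumeForm o) x y v = τ * η v := by
    intro y hy
    obtain ⟨s, hs, hsv⟩ := hU y hy
    set p := (chartAt (E 3) x).symm y
    have hp := g.isScalarProduct p
    have hf := hp.frame (finrank_tangentSpace p)
    have h0 := alternating_frame_ne_zero hf hp (finrank_tangentSpace p)
      (o.orient p).someVector_ne_zero
    have hv : ∀ v, FormField.inChart (g.volumeForm o) x y v =
        (|(o.orient p).someVector (frame 3 (g.at p))|⁻¹ * s) * η v := fun v => by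
      rw [mul_assoc, ← hsv]
      rfl
    refine ⟨_, mul_pos (inv_pos.mpr (abs_pos.mpr h0)) hs, ?_, hv⟩
    rw [← hv, ← g.volumeForm_frame_sq o p]
    exact alternating_sq_frame hf hp (finrank_tangentSpace p) _
      fun i j => (hG.scalar y (hUt hy)).frame h3 i j
  -- Positivity and the normalisation determine the factor: it must be `√D / |η b|`. This gives the
  -- smoothness that the pointwise choice lacks.
  have hτ : ∀ y ∈ U, ∀ τ : ℝ, 0 < τ →
      (τ * η (frame 3 fun u v => g.chartForm x y u v)) ^ 2 = 1 →
      0 < D y ∧ τ = √(D y) / |η b| := by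
    intro y hy τ hτ h1
    have hs := hG.scalar y (hUt hy)
    have h2 : (τ * |η b|) ^ 2 = D y := by
      rw [mul_pow, sq_abs, alternating_sq (hs.frame h3) hs h3, ← mul_assoc, ← mul_pow, h1, one_mul]
    have h4 : 0 < τ * |η b| := mul_pos hτ (abs_pos.mpr hηb)
    rw [← h2, Real.sqrt_sq h4.le, mul_div_cancel_right₀ _ (abs_ne_zero.mpr hηb)]
    exact ⟨pow_pos h4 2, rfl⟩
  refine ⟨U, fun y => √(D y) / |η b|, η, hxU, hUt,
    { isOpen := hUo
      contDiffOn := hG.contDiffOn.mono hUt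
      scalar := fun y hy => hG.scalar y (hUt hy)
      contDiffOn_density := ?_
      sq_eq_one := fun y hy => ?_ }, fun y hy v => ?_⟩
  · have hc : ∀ u v, ContDiffOn ℝ ∞ (fun y => g.chartForm x y u v) U := fun u v =>
      (g.contDiffOn_inChart x u v).mono hUt
    have hDc : ContDiffOn ℝ ∞ D U := by
      simp only [hD, gramDet]
      fun_prop
    refine ContDiffOn.div_const (hDc.sqrt fun y hy => ?_) _
    obtain ⟨τ, h0, h1, -⟩ := key y hy
    exact (hτ y hy τ h0 h1).1.ne'
  · obtain ⟨τ, h0, h1, -⟩ := key y hy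
    rwa [← (hτ y hy τ h0 h1).2]
  · obtain ⟨τ, h0, h1, h2⟩ := key y hy
    rw [h2, (hτ y hy τ h0 h1).2]

end VolumeForm

/-! ### The flow equations at a fixed time -/

section FixedTime

variable {M : Type*} [TopologicalSpace M] [ChartedSpace (E 3) M] [IsManifold (𝓡 3) ∞ M]
  (g : Metric 3 M) (o : ManifoldOrientation 3 M) {f : M → ℝ}

theorem contDiffOn_comp_chart_symm (hf : ContMDiff (𝓡 3) 𝓘(ℝ, ℝ) ∞ f) (x : M) :
    ContDiffOn ℝ ∞ (fun y => f ((chartAt (E 3) x).symm y)) (chartAt (E 3) x).target :=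
  (hf.comp_contMDiffOn (contMDiffOn_chart_symm (I := 𝓡 3) (x := x))).contDiffOn

omit [IsManifold (𝓡 3) ∞ M] in
theorem fderiv_comp_chart_symm (hf : ContMDiff (𝓡 3) 𝓘(ℝ, ℝ) ∞ f) (x : M)
    (v : TangentSpace (𝓡 3) x) :
    fderiv ℝ (fun y => f ((chartAt (E 3) x).symm y)) (chartAt (E 3) x x) v =
      differential f x v := by
  have h : MDifferentiableAt (𝓡 3) 𝓘(ℝ, ℝ) f x := hf.mdifferentiable (by simp) x
  have hr : Set.range (𝓡 3) = Set.univ := (𝓡 3).range_eq_univ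
  have h1 := h.mfderiv
  rw [hr, fderivWithin_univ] at h1
  exact (congrArg (fun l : E 3 →L[ℝ] ℝ => l v) h1).symm

theorem Metric.riemann_eq (x : M) : g.riemann x = fun u v a b : E 3 =>
    g.chartForm x (chartAt (E 3) x x)
      (curvatureMap (leviCivita (g.chartForm x)) (chartAt (E 3) x x) u v a) b := by
  funext u v a b
  simp only [Metric.riemann, toChart_eq]
  exact congrArg (fun w : E 3 => g.chartForm x (chartAt (E 3) x x) w b)
    ((g.isLocalMetric x).curvature_christoffel (mem_chart_target (E 3) x) u v a)

theorem Metric.isCurvatureTensor_riemann (x : M) : IsCurvatureTensor (g.riemann x) := by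
  have h := (g.isLocalMetric x).isCurvatureTensor (mem_chart_target (E 3) x)
  rw [g.riemann_eq]
  exact h

theorem Metric.localVolume_form {x : M} {U : Set (E 3)} {ρ : E 3 → ℝ}
    {η : E 3 [⋀^Fin 3]→ₗ[ℝ] ℝ}
    (h : ∀ y ∈ U, ∀ v, FormField.inChart (g.volumeForm o) x y v = ρ y * η v) (f : M → ℝ) :
    ∀ y ∈ U, ∀ v, FormField.inChart (fun x => f x • g.volumeForm o x) x y v =
      f ((chartAt (E 3) x).symm y) * (ρ y * η v) := by
  intro y hy v
  rw [← h y hy]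
  rfl

theorem Metric.torsionCurvature_eq (hf : ContMDiff (𝓡 3) 𝓘(ℝ, ℝ) ∞ f) (x : M) :
    g.torsionCurvature (fun x => f x • g.volumeForm o x) x =
      skewTorsionCurvature (g.at x) (g.riemann x) (g.volumeForm o x) (f x)
        (differential f x) := by
  obtain ⟨U, ρ, η, hxU, hUt, hν, hη⟩ := g.exists_localVolume o x
  have hx := mem_chart_target (E 3) x
  have hφ := (contDiffOn_comp_chart_symm hf x).mono hUt
  funext u v a b
  have h := hν.curvature_torsionConnection hxU hφ (g.localVolume_form o hη f) u v a b
  have hvol : ∀ w : Fin 3 → TangentSpace (𝓡 3) x, ρ (chartAt (E 3) x x) * η w =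
      g.volumeForm o x w := fun w =>
    (hη _ hxU w).symm.trans (FormField.inChart_self _ x w)
  have hB : ∀ u v : TangentSpace (𝓡 3) x,
      g.chartForm x (chartAt (E 3) x x) u v = g.at x u v := g.inChart_self x
  have hfx : f ((chartAt (E 3) x).symm (chartAt (E 3) x x)) = f x := by
    rw [(chartAt (E 3) x).left_inv (mem_chart_source (E 3) x)]
  have h2 : g.torsionCurvature (fun x => f x • g.volumeForm o x) x u v a b =
      g.chartForm x (chartAt (E 3) x x) (curvature (torsionConnection
        (fun y u v => g.chartForm x y u v)
        (FormField.inChart (fun x => f x • g.volumeForm o x) x)) (chartAt (E 3) x x) u v a) b := by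
    simp only [Metric.torsionCurvature, toChart_eq]
    rfl
  rw [h2, h]
  simp only [skewTorsionCurvature, AlternatingMap.smul_apply, smul_eq_mul]
  rw [g.riemann_eq, hfx, ← fderiv_comp_chart_symm hf x u, ← fderiv_comp_chart_symm hf x v, ← hvol, ← hvol,
    ← hB, ← hB, ← hB, ← hB]
  rfl

theorem Metric.dCodiff_eq (hf : ContMDiff (𝓡 3) 𝓘(ℝ, ℝ) ∞ f) (x : M)
    (v : Fin 3 → TangentSpace (𝓡 3) x) :
    g.dCodiff (k := 2) (fun x => f x • g.volumeForm o x) x v =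
      g.laplacian f x * g.volumeForm o x v := by
  obtain ⟨U, ρ, η, hxU, hUt, hν, hη⟩ := g.exists_localVolume o x
  have hφ := (contDiffOn_comp_chart_symm hf x).mono hUt
  have h := hν.extDer_codiff hφ (g.localVolume_form o hη f) hxU v
  have hvol : ρ (chartAt (E 3) x x) * η v = g.volumeForm o x v :=
    (hη _ hxU v).symm.trans (FormField.inChart_self _ x v)
  simp only [Metric.dCodiff, toChart_eq]
  exact h.trans (congrArg (fun r => g.laplacian f x * r) hvol)

theorem Metric.exteriorDeriv_eq_zero (hf : ContMDiff (𝓡 3) 𝓘(ℝ, ℝ) ∞ f) (x : M)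
    (v : Fin 4 → TangentSpace (𝓡 3) x) :
    FormField.exteriorDeriv (k := 3) (fun x => f x • g.volumeForm o x) x v = 0 := by
  obtain ⟨U, ρ, η, hxU, hUt, hν, hη⟩ := g.exists_localVolume o x
  exact hν.extDer_eq_zero ((contDiffOn_comp_chart_symm hf x).mono hUt)
    (g.localVolume_form o hη f) hxU _

/-- Each `R(eᵢ, eⱼ)` is a two-form in dimension three, so its wedge square vanishes. -/
theorem Metric.curvWedge_eq_zero (hf : ContMDiff (𝓡 3) 𝓘(ℝ, ℝ) ∞ f) (x : M)
    (v : Fin 4 → TangentSpace (𝓡 3) x) :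
    curvWedge 3 (g.at x) (g.torsionCurvature (fun x => f x • g.volumeForm o x) x) v = 0 := by
  have hB := g.isScalarProduct x
  have hR := g.isCurvatureTensor_riemann x
  have hα : IsLinearMap ℝ (differential (d := 3) f x) := ⟨map_add _, map_smul _⟩
  rw [curvWedge, g.torsionCurvature_eq o hf]
  simp only [wedgeTwoForms_self (hB.frame (finrank_tangentSpace x)) hB (finrank_tangentSpace x)
    (fun v => skewTorsionCurvature_linear hB hR _ _ hα v _ _)
    (fun u v => skewTorsionCurvature_antisymm hR _ _ _ u v _ _), Finset.sum_const_zero, mul_zero]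

theorem Metric.isSmooth_smul_volumeForm (hf : ContMDiff (𝓡 3) 𝓘(ℝ, ℝ) ∞ f) :
    FormField.IsSmooth (d := 3) (k := 3) (fun x => f x • g.volumeForm o x) := by
  intro x v
  obtain ⟨U, ρ, η, hxU, hUt, hν, hη⟩ := g.exists_localVolume o x
  have hφ := (contDiffOn_comp_chart_symm hf x).mono hUt
  have h : ContDiffOn ℝ ∞ (fun y => f ((chartAt (E 3) x).symm y) * (ρ y * η v)) U :=
    hφ.mul (hν.contDiffOn_density.mul contDiffOn_const)
  refine (h.contDiffAt (hν.isOpen.mem_nhds hxU)).congr_of_eventuallyEq ?_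
  filter_upwards [hν.isOpen.mem_nhds hxU] with y hy using g.localVolume_form o hη f y hy v

/-- The two right-hand sides of the metric equation agree. -/
theorem Metric.flow_rhs_eq (hf : ContMDiff (𝓡 3) 𝓘(ℝ, ℝ) ∞ f) (κ : ℝ) (x : M)
    (u v : TangentSpace (𝓡 3) x) :
    -2 * (g.ricci x u v - 1 / 2 * threeFormComp 3 (g.at x) (f x • g.volumeForm o x) u v)
        - 2 * κ * curvComp 3 (g.at x)
          (g.torsionCurvature (fun x => f x • g.volumeForm o x) x) u v =
      2 * κ * bilinComp 3 (g.at x) (g.ricci x) u v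
        - (2 + κ * (2 * g.scalar x - f x ^ 2)) * g.ricci x u v
        + (f x ^ 2 + κ * (g.scalar x ^ 2 - 2 * normSqBilin 3 (g.at x) (g.ricci x)
            - 1 / 2 * normSqCovector 3 (g.at x) (differential f x) - 1 / 4 * f x ^ 4)) * g.at x u v
        - κ * commutator 3 (g.at x) (g.starOneForm o x (differential f x)) (g.ricci x) u v
        - 1 / 2 * κ * (differential f x u * differential f x v) := by
  rw [g.torsionCurvature_eq o hf]
  exact flow_metric_rhs_eq (g.isScalarProduct x) (finrank_tangentSpace x)
    (g.isCurvatureTensor_riemann x) (g.volumeForm_frame_sq o x) κ (f x)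
    ⟨map_add _, map_smul _⟩ rfl u v

end FixedTime

/-! ### Time derivatives -/

section Time

variable {M : Type*} [TopologicalSpace M] [ChartedSpace (E 3) M] [IsManifold (𝓡 3) ∞ M]
  (o : ManifoldOrientation 3 M) {J : Set ℝ} {g : ℝ → Metric 3 M} {t : ℝ} {x : M}
  {g' : TangentSpace (𝓡 3) x → TangentSpace (𝓡 3) x → ℝ}

/-- `∂ₜ ν = ½ Tr(∂ₜ g) ν`. -/
theorem hasDerivWithinAt_volumeForm
    (hg : ∀ u v, HasDerivWithinAt (fun s => (g s).at x u v) (g' u v) J t)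
    (v : Fin 3 → TangentSpace (𝓡 3) x) :
    HasDerivWithinAt (fun s => (g s).volumeForm o x v)
      (1 / 2 * trace 3 ((g t).at x) g' * (g t).volumeForm o x v) J t := by
  -- The frame is orthonormal at time `t` and held fixed in `s`. Its Gram matrix is the identity at
  -- `s = t`, where the derivative of the determinant is the trace.
  set b := frame 3 ((g t).at x)
  have hb : IsOrthonormalFrame ((g t).at x) b :=
    ((g t).isScalarProduct x).frame (finrank_tangentSpace x)
  have hσ : ∀ s, (o.orient x).someVector (frame 3 ((g s).at x)) ≠ 0 := fun s =>
    alternating_frame_ne_zero (((g s).isScalarProduct x).frame (finrank_tangentSpace x))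
      ((g s).isScalarProduct x) (finrank_tangentSpace x) (o.orient x).someVector_ne_zero
  set σ := (o.orient x).someVector
  have hval : ∀ s, (g s).volumeForm o x v = √(gramDet ((g s).at x) b) * (σ v / |σ b|) := by
    intro s
    have h := (g s).isScalarProduct x
    have hsq := alternating_sq (h.frame (finrank_tangentSpace x)) h (finrank_tangentSpace x)
      ((g s).volumeForm o x) b
    rw [(g s).volumeForm_frame_sq o x, one_mul] at hsq
    have hv : ∀ v, (g s).volumeForm o x v = |σ (frame 3 ((g s).at x))|⁻¹ * σ v := fun _ => rfl
    have habs : √(gramDet ((g s).at x) b) = |σ (frame 3 ((g s).at x))|⁻¹ * |σ b| := by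
      rw [← hsq, Real.sqrt_sq_eq_abs, hv, abs_mul, abs_of_pos (inv_pos.mpr (abs_pos.mpr (hσ s)))]
    rw [habs, hv, mul_assoc, mul_div_cancel₀ _ (abs_ne_zero.mpr (hσ t))]
  have hD : HasDerivWithinAt (fun s => gramDet ((g s).at x) b) (trace 3 ((g t).at x) g') J t := by
    have h := (((hg (b 0) (b 0)).mul (((hg (b 1) (b 1)).mul (hg (b 2) (b 2))).sub
      ((hg (b 1) (b 2)).mul (hg (b 2) (b 1))))).sub ((hg (b 0) (b 1)).mul
      (((hg (b 1) (b 0)).mul (hg (b 2) (b 2))).sub ((hg (b 1) (b 2)).mul (hg (b 2) (b 0)))))).add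
      ((hg (b 0) (b 2)).mul (((hg (b 1) (b 0)).mul (hg (b 2) (b 1))).sub
      ((hg (b 1) (b 1)).mul (hg (b 2) (b 0)))))
    obtain ⟨h00, h01, h02, h10, h11, h12, h20, h21, h22⟩ := hb.values
    simp only [Pi.mul_apply, Pi.sub_apply, h00, h01, h02, h10, h11, h12, h20, h21, h22] at h
    refine HasDerivWithinAt.congr_deriv (f' := _) h ?_
    rw [trace, Fin.sum_univ_three]
    ring
  have h1 : gramDet ((g t).at x) b = 1 := gramDet_frame hb
  have h := (hD.sqrt (by rw [h1]; exact one_ne_zero)).mul_const (σ v / |σ b|)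
  simp only [hval]
  refine h.congr_deriv ?_
  rw [h1, Real.sqrt_one]
  ring

/-- The torsion equation is the scalar equation, once the metric is differentiable in time. -/
theorem torsion_eq_iff {f : ℝ → M → ℝ}
    (hg : ∀ u v, HasDerivWithinAt (fun s => (g s).at x u v) (g' u v) J t) (L : ℝ) :
    (∀ v : Fin 3 → TangentSpace (𝓡 3) x,
      HasDerivWithinAt (fun s => (f s x • (g s).volumeForm o x) v)
        (-(L * (g t).volumeForm o x v)) J t) ↔
    HasDerivWithinAt (fun s => f s x) (-L - 1 / 2 * trace 3 ((g t).at x) g' * f t x) J t := by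
  constructor
  · intro h
    set b := frame 3 ((g t).at x)
    have hσ : ∀ s, (o.orient x).someVector (frame 3 ((g s).at x)) ≠ 0 := fun s =>
      alternating_frame_ne_zero (((g s).isScalarProduct x).frame (finrank_tangentSpace x))
        ((g s).isScalarProduct x) (finrank_tangentSpace x) (o.orient x).someVector_ne_zero
    have hne : ∀ s, (g s).volumeForm o x b ≠ 0 := fun s =>
      mul_ne_zero (inv_ne_zero (abs_ne_zero.mpr (hσ s))) (hσ t)
    -- On `b` the volume form never vanishes in `s`, so `f` is recovered as a quotient and its
    -- differentiability follows from that of `H` and `ν`.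
    have h2 := (h b).div (hasDerivWithinAt_volumeForm o hg b) (hne t)
    have h3 : HasDerivWithinAt (fun s => f s x) _ J t := h2.congr_of_eventuallyEq
      (Filter.Eventually.of_forall fun s => by
        simp only [AlternatingMap.smul_apply, smul_eq_mul, Pi.div_apply]
        rw [mul_div_cancel_right₀ _ (hne s)])
      (by
        simp only [AlternatingMap.smul_apply, smul_eq_mul, Pi.div_apply]
        rw [mul_div_cancel_right₀ _ (hne t)])
    refine h3.congr_deriv ?_
    have := hne t
    simp only [AlternatingMap.smul_apply, smul_eq_mul]
    field_simp
  · intro h v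
    refine (h.mul (hasDerivWithinAt_volumeForm o hg v)).congr_deriv ?_
    ring

end Time

/-- Positive length makes derivatives along `J` unique, endpoints included, so `derivWithin` agrees
with any derivative asserted by the flow. -/
theorem uniqueDiffOn_of_ordConnected {J : Set ℝ} (hJ : J.OrdConnected) (hJ' : J.Nontrivial) :
    UniqueDiffOn ℝ J := by
  obtain ⟨a, ha, b, hb, hab⟩ := hJ'.exists_lt
  refine uniqueDiffOn_convex hJ.convex ⟨(a + b) / 2, mem_interior.mpr
    ⟨Set.Ioo a b, fun c hc => hJ.out ha hb ⟨hc.1.le, hc.2.le⟩, isOpen_Ioo, ?_, ?_⟩⟩ <;> linarith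

end HeteroticRicci

/-! ### Equivalence of the flow with the system for the metric and the function -/

theorem mainTheorem11 {M : Type*} [TopologicalSpace M]
    [ChartedSpace (EuclideanSpace ℝ (Fin 3)) M] [IsManifold (𝓡 3) ∞ M]
    (o : HeteroticRicci.ManifoldOrientation 3 M) (κ : ℝ)
    (J : Set ℝ) (hJ : J.OrdConnected) (hJ' : J.Nontrivial)
    (g : ℝ → HeteroticRicci.Metric 3 M) (f : ℝ → M → ℝ)
    (hf : ∀ t ∈ J, ContMDiff (𝓡 3) 𝓘(ℝ, ℝ) ∞ (f t)) :
    HeteroticRicci.IsHeteroticRicciFlow κ J g (fun t x => f t x • (g t).volumeForm o x) ↔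
      ∀ t ∈ J, ∀ x : M,
        (∀ u v : TangentSpace (𝓡 3) x,
          HasDerivWithinAt (fun s => (g s).at x u v)
            (2 * κ * HeteroticRicci.bilinComp 3 ((g t).at x) ((g t).ricci x) u v
              - (2 + κ * (2 * (g t).scalar x - f t x ^ 2)) * (g t).ricci x u v
              + (f t x ^ 2 + κ * ((g t).scalar x ^ 2
                  - 2 * HeteroticRicci.normSqBilin 3 ((g t).at x) ((g t).ricci x)
                  - 1 / 2 * HeteroticRicci.normSqCovector 3 ((g t).at x)
                      (HeteroticRicci.differential (f t) x)
                  - 1 / 4 * f t x ^ 4)) * (g t).at x u v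
              - κ * HeteroticRicci.commutator 3 ((g t).at x)
                  ((g t).starOneForm o x (HeteroticRicci.differential (f t) x))
                  ((g t).ricci x) u v
              - 1 / 2 * κ * (HeteroticRicci.differential (f t) x u
                  * HeteroticRicci.differential (f t) x v)) J t) ∧
        DifferentiableWithinAt ℝ (fun s => f s x) J t ∧
        derivWithin (fun s => f s x) J t
          + 1 / 2 * HeteroticRicci.trace 3 ((g t).at x)
              (HeteroticRicci.metricDot J g t x) * f t x
          + (g t).laplacian (f t) x = 0 := by
  have hU := HeteroticRicci.uniqueDiffOn_of_ordConnected hJ hJ'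
  -- Differentiability of the metric is needed for `∂ₜν` and for `metricDot` to be a true derivative
  -- rather than a default value. In either direction of the equivalence the metric equation
  -- supplies it.
  have scalar_iff : ∀ t ∈ J, ∀ x : M,
      (∀ u v, DifferentiableWithinAt ℝ (fun s => (g s).at x u v) J t) →
      ((∀ v : Fin 3 → TangentSpace (𝓡 3) x,
        HasDerivWithinAt (fun s => (f s x • (g s).volumeForm o x) v)
          (-(g t).dCodiff (k := 2) (fun x => f t x • (g t).volumeForm o x) x v) J t) ↔
      (DifferentiableWithinAt ℝ (fun s => f s x) J t ∧
        derivWithin (fun s => f s x) J t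
          + 1 / 2 * HeteroticRicci.trace 3 ((g t).at x)
              (HeteroticRicci.metricDot J g t x) * f t x
          + (g t).laplacian (f t) x = 0)) := by
    intro t ht x hg
    simp only [(g t).dCodiff_eq o (hf t ht)]
    rw [HeteroticRicci.torsion_eq_iff o (fun u v => (hg u v).hasDerivWithinAt)]
    constructor
    · intro h
      refine ⟨h.differentiableWithinAt, ?_⟩
      rw [h.derivWithin (hU t ht)]
      unfold HeteroticRicci.metricDot
      ring
    · rintro ⟨h, h'⟩
      refine h.hasDerivWithinAt.congr_deriv ?_
      unfold HeteroticRicci.metricDot at h'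
      linear_combination h'
  constructor
  · intro h t ht x
    have hm := h.metric_eq t ht x
    refine ⟨fun u v => (hm u v).congr_deriv ((g t).flow_rhs_eq o (hf t ht) κ x u v), ?_⟩
    exact (scalar_iff t ht x fun u v => (hm u v).differentiableWithinAt).mp (h.torsion_eq t ht x)
  · intro h
    refine ⟨fun t ht => (g t).isSmooth_smul_volumeForm o (hf t ht), fun t ht x u v => ?_,
      fun t ht x => ?_, fun t ht x v => ?_⟩
    · exact ((h t ht x).1 u v).congr_deriv ((g t).flow_rhs_eq o (hf t ht) κ x u v).symm
    · exact (scalar_iff t ht x fun u v => ((h t ht x).1 u v).differentiableWithinAt).mpr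
        (h t ht x).2
    · rw [(g t).exteriorDeriv_eq_zero o (hf t ht), (g t).curvWedge_eq_zero o (hf t ht), mul_zero,
        add_zero]
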